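/- Let $F_0$ be a number field of degree $n_0$ over $\mathbb{Q}$ and let $F$ be a quadratic extension of $F_0$. A Hecke character of $F$ is a continuous homomorphism from the idèle class group $C_F=\mathbb{A}_F^\times/F^\times$ to the unit circle. The component of a Hecke character $\chi$ at an infinite place $\sigma$ of $F$ can be written $\chi_\sigma(x)=\left(\sigma(x)/|\sigma(x)|\right)^{k_\sigma}|x|_\sigma^{i\varphi_\sigma}$, where $|x|_\sigma=|\sigma(x)|^{n_\sigma}$ with $n_\sigma=1$ if $\sigma$ is real and $n_\sigma=2$ if $\sigma$ is complex, for a unique $\varphi_\sigma\in\mathbb{R}$ and a unique $k_\sigma$, with $k_\sigma\in\{0,1\}$ if $\sigma$ is real and $k_\sigma\in\mathbb{Z}$ if $\sigma$ is complex. Call $\chi$ almost-algebraic if $\varphi_\sigma=0$ for all infinite places $\sigma$ of $F$, and partially algebraic if $\varphi_\sigma=0$ for some infinite place $\sigma$ but not for all of them. A modulus $\mathfrak{m}$ of $F$ is a nonzero integral ideal $\mathfrak{m}_f$ together with a set $\mathfrak{m}_\infty$ of real places of $F$; let $U(\mathfrak{m})$ be the group of idèles whose component at every finite prime $\mathfrak{p}$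 is a $\mathfrak{p}$-adic unit congruent to $1$ modulo $\mathfrak{p}^{v_{\mathfrak{p}}(\mathfrak{m}_f)}$, whose component is $1$ at the complex places and at the places in $\mathfrak{m}_\infty$, and is $\pm1$ at the other real places. Let $\widehat{C}_{\mathfrak{m}}$ be the group of Hecke characters of $F$ that are trivial on $U(\mathfrak{m})$. Let $R$ be the set of real places of $F_0$ that become complex in $F$; each $\sigma\in R$ is identified with the unique (complex) place of $F$ above it. Let $r$ be the degree over $\mathbb{Q}$ of the maximal totally real subfield of $F$ if $F$ contains a CM subfield (that is, a totally complex quadratic extension of a totally real number field; possibly $F$ itself), and $r=0$ otherwise. Then for every modulus $\mathfrak{m}$ of $F$ there exists a subgroup $H$ of $\widehat{C}_{\mathfrak{m}}$ of rank $n_0-r$ such that every character in $H$ satisfies $\varphi_\sigma=0$ for every $\sigma\in R$, and such that $H$ contains no nontrivial almost-algebraic character. In particular, if $F$ is not a CM field, then there exists a partially algebraic Hecke character of $F$. -/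

import Mathlib

open NumberField IsDedekindDomain

noncomputable section

namespace Hecke

universe u

/-- The idèle group of `F`, with the topology of the units of the adèle ring. -/
abbrev Idele (F : Type u) [Field F] [NumberField F] : Type u := (AdeleRing (𝓞 F) F)ˣ

/-- The subgroup of principal idèles: the image of `Fˣ` under the diagonal embedding. -/
def principalIdeles (F : Type u) [Field F] [NumberField F] : Subgroup (Idele F) :=
  (Units.map (algebraMap F (AdeleRing (𝓞 F) F)).toMonoidHom).range

/-- The idèle class group of `F`, with the quotient topology. -/
abbrev IdeleClassGroup (F : Type u) [Field F] [NumberField F] : Type u :=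
  Idele F ⧸ principalIdeles F

/-- The group of Hecke characters of `F`: continuous homomorphisms from the idèle class group
to the unit circle. -/
abbrev HeckeCharacter (F : Type u) [Field F] [NumberField F] : Type u :=
  PontryaginDual (IdeleClassGroup F)

variable {F : Type u} [Field F] [NumberField F]

/-- The component of an idèle at an infinite place. -/
def infComponent (w : InfinitePlace F) (x : Idele F) : w.Completion :=
  (x : AdeleRing (𝓞 F) F).1 w

/-- The component of an idèle at a finite place. -/
def finComponent (v : HeightOneSpectrum (𝓞 F)) (x : Idele F) : v.adicCompletion F :=
  (x : AdeleRing (𝓞 F) F).2 v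

theorem infComponent_one (w : InfinitePlace F) : infComponent w (1 : Idele F) = 1 := rfl

theorem finComponent_one (v : HeightOneSpectrum (𝓞 F)) : finComponent v (1 : Idele F) = 1 := rfl

theorem infComponent_mul (w : InfinitePlace F) (x y : Idele F) :
    infComponent w (x * y) = infComponent w x * infComponent w y := rfl

theorem finComponent_mul (v : HeightOneSpectrum (𝓞 F)) (x y : Idele F) :
    finComponent v (x * y) = finComponent v x * finComponent v y := rfl

open Classical in
/-- The embedding of the multiplicative group of the completion at the infinite place `w` into the
idèles: the idèle has component `x` at `w` and `1` at every other place. -/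
def localEmbedding (w : InfinitePlace F) : w.Completionˣ →* Idele F :=
  (MulEquiv.prodUnits (M := InfiniteAdeleRing F)
      (N := FiniteAdeleRing (𝓞 F) F)).symm.toMonoidHom.comp
    ((MonoidHom.inl (InfiniteAdeleRing F)ˣ (FiniteAdeleRing (𝓞 F) F)ˣ).comp
      ((MulEquiv.piUnits (M := fun w : InfinitePlace F => w.Completion)).symm.toMonoidHom.comp
        (MonoidHom.mulSingle (fun w : InfinitePlace F => w.Completionˣ) w)))

open Classical in
theorem infComponent_localEmbedding_same (w : InfinitePlace F) (x : w.Completionˣ) :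
    infComponent w (localEmbedding w x) = x :=
  congrArg Units.val (Pi.mulSingle_eq_same (M := fun w : InfinitePlace F => w.Completionˣ) w x)

open Classical in
theorem infComponent_localEmbedding_of_ne {w w' : InfinitePlace F} (h : w' ≠ w)
    (x : w.Completionˣ) : infComponent w' (localEmbedding w x) = 1 :=
  congrArg Units.val
    (Pi.mulSingle_eq_of_ne (M := fun w : InfinitePlace F => w.Completionˣ) h x)

theorem finComponent_localEmbedding (v : HeightOneSpectrum (𝓞 F)) (w : InfinitePlace F)
    (x : w.Completionˣ) : finComponent v (localEmbedding w x) = 1 := rfl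

/-- The component at the infinite place `w` of a Hecke character. -/
def localComponent (χ : HeckeCharacter F) (w : InfinitePlace F) (x : w.Completionˣ) : Circle :=
  χ (QuotientGroup.mk (localEmbedding w x))

/-- `(k, φ)` are the local parameters of `χ` at the infinite place `w`:
if `σ` is the embedding of the completion into `ℂ` attached to `w`, then
`χ_w(x) = (σ x / |σ x|) ^ k * |x|_w ^ (i φ)`, where `|x|_w = ‖x‖ ^ n_w` is the normalized absolute
value (`n_w = 1` for `w` real and `n_w = 2` for `w` complex). At a real place the first factor is
`sgn(x) ^ k`, and `k` is normalized to be `0` or `1`. -/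
def HasLocalParameters (χ : HeckeCharacter F) (w : InfinitePlace F) (k : ℤ) (φ : ℝ) : Prop :=
  (w.IsReal → k = 0 ∨ k = 1) ∧
  ∀ x : w.Completionˣ,
    (localComponent χ w x : ℂ) =
      (InfinitePlace.Completion.extensionEmbedding w (x : w.Completion) /
          (‖InfinitePlace.Completion.extensionEmbedding w (x : w.Completion)‖ : ℂ)) ^ k *
        ((‖(x : w.Completion)‖ ^ w.mult : ℝ) : ℂ) ^ ((φ : ℂ) * Complex.I)

/-- The continuous parameter `φ` of `χ` at the infinite place `w` equals `φ`. -/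
def HasPhi (χ : HeckeCharacter F) (w : InfinitePlace F) (φ : ℝ) : Prop :=
  ∃ k : ℤ, HasLocalParameters χ w k φ

/-- A Hecke character is almost-algebraic if `φ_w = 0` for all infinite places `w`. -/
def IsAlmostAlgebraic (χ : HeckeCharacter F) : Prop :=
  ∀ w : InfinitePlace F, HasPhi χ w 0

/-- A Hecke character is partially algebraic if `φ_w = 0` for some infinite place `w`, but not
for all of them. -/
def IsPartiallyAlgebraic (χ : HeckeCharacter F) : Prop :=
  (∃ w : InfinitePlace F, HasPhi χ w 0) ∧
    ∃ w : InfinitePlace F, ∃ φ : ℝ, φ ≠ 0 ∧ HasPhi χ w φ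

variable (F) in
/-- A modulus of `F`: a nonzero integral ideal together with a set of real places. -/
structure Modulus where
  finitePart : Ideal (𝓞 F)
  finitePart_ne_bot : finitePart ≠ ⊥
  infinitePart : Set (InfinitePlace F)
  isReal_of_mem : ∀ w ∈ infinitePart, w.IsReal

/-- The exponent of the prime `v` in the finite part of the modulus. -/
def Modulus.exponent (m : Modulus F) (v : HeightOneSpectrum (𝓞 F)) : ℕ :=
  multiplicity v.asIdeal m.finitePart

/-- The group `U(m)` of idèles congruent to `1` modulo `m`. At a finite place `v` the component is
a unit congruent to `1` modulo `v ^ e`, where `e` is the exponent of `v` in `m`; it is `1` at the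
complex places and at the real places in `m`, and `1` or `-1` at the other real places. -/
def Modulus.congruenceSubgroup (m : Modulus F) : Subgroup (Idele F) where
  carrier := {x |
    (∀ v : HeightOneSpectrum (𝓞 F), Valued.v (finComponent v x) = 1 ∧
      Valued.v (finComponent v x - 1) ≤ WithZero.exp (-(m.exponent v : ℤ))) ∧
    (∀ w : InfinitePlace F, infComponent w x = 1 ∨
      (w.IsReal ∧ w ∉ m.infinitePart ∧ infComponent w x = -1))}
  one_mem' := by
    refine ⟨fun v => ?_, fun w => Or.inl (infComponent_one w)⟩
    rw [finComponent_one]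
    simp
  mul_mem' := by
    rintro x y ⟨hx, hx'⟩ ⟨hy, hy'⟩
    refine ⟨fun v => ?_, fun w => ?_⟩
    · obtain ⟨h1, h2⟩ := hx v
      obtain ⟨h3, h4⟩ := hy v
      rw [finComponent_mul]
      refine ⟨by rw [map_mul, h1, h3, one_mul], ?_⟩
      have e : finComponent v x * finComponent v y - 1 =
          finComponent v x * (finComponent v y - 1) + (finComponent v x - 1) := by ring
      rw [e]
      refine (Valuation.map_add _ _ _).trans (max_le ?_ h2)
      rw [map_mul, h1, one_mul]
      exact h4
    · rw [infComponent_mul]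
      rcases hx' w with h | ⟨r, n, h⟩ <;> rcases hy' w with h' | ⟨r', n', h'⟩ <;>
        simp_all
  inv_mem' := by
    rintro x ⟨hx, hx'⟩
    refine ⟨fun v => ?_, fun w => ?_⟩
    · obtain ⟨h1, h2⟩ := hx v
      have e : finComponent v x * finComponent v x⁻¹ = 1 := by
        rw [← finComponent_mul, mul_inv_cancel, finComponent_one]
      have h3 : Valued.v (finComponent v x⁻¹) = 1 := by
        have := congrArg Valued.v e
        rwa [map_mul, h1, one_mul, map_one] at this
      refine ⟨h3, ?_⟩
      have e' : finComponent v x⁻¹ - 1 =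
          -(finComponent v x⁻¹ * (finComponent v x - 1)) := by
        rw [mul_sub, mul_comm, e]; ring
      rw [e', Valuation.map_neg, map_mul, h3, one_mul]
      exact h2
    · have e : infComponent w x * infComponent w x⁻¹ = 1 := by
        rw [← infComponent_mul, mul_inv_cancel, infComponent_one]
      rcases hx' w with h | ⟨r, n, h⟩
      · left
        rwa [h, one_mul] at e
      · right
        refine ⟨r, n, ?_⟩
        rw [h, neg_one_mul] at e
        exact neg_eq_iff_eq_neg.mp e

/-- The group of Hecke characters of modulus `m`: the Hecke characters trivial on `U(m)`. -/
def characterGroup (m : Modulus F) : Subgroup (HeckeCharacter F) where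
  carrier := {χ | ∀ x ∈ m.congruenceSubgroup, χ (QuotientGroup.mk x) = 1}
  one_mem' := fun _ _ => rfl
  mul_mem' := by
    intro χ ψ hχ hψ x hx
    change χ _ * ψ _ = 1
    rw [hχ x hx, hψ x hx, one_mul]
  inv_mem' := by
    intro χ hχ x hx
    change (χ _)⁻¹ = 1
    rw [hχ x hx, inv_one]

variable (F) in
open Classical in
/-- The degree over `ℚ` of the maximal (totally) real subfield of `F` if `F` contains a CM
subfield, and `0` otherwise. -/
def cmRank : ℕ :=
  if ∃ K : IntermediateField ℚ F, IsCMField K then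
    Module.finrank ℚ (maximalRealSubfield F)
  else 0

end Hecke

end

set_option linter.unusedSectionVars false

/-! ### Characters of `ℂˣ` -/

/-- The unitary character `z ↦ z / |z|` of `ℂˣ`. -/
noncomputable def Circle.ofUnits : ℂˣ →* Circle where
  toFun z := ⟨(z : ℂ) / ‖(z : ℂ)‖, mem_sphere_zero_iff_norm.mpr (by simp)⟩
  map_one' := by ext; simp
  map_mul' x y := by
    ext
    change ((x * y : ℂˣ) : ℂ) / ‖((x * y : ℂˣ) : ℂ)‖ =
      (x : ℂ) / ‖(x : ℂ)‖ * ((y : ℂ) / ‖(y : ℂ)‖)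
    simp [mul_div_mul_comm]

theorem Circle.coe_ofUnits (z : ℂˣ) : (Circle.ofUnits z : ℂ) = (z : ℂ) / ‖(z : ℂ)‖ := rfl

theorem Circle.continuous_ofUnits : Continuous Circle.ofUnits := by
  refine Continuous.subtype_mk (Units.continuous_val.div ?_ ?_) _
  · exact Complex.continuous_ofReal.comp Units.continuous_val.norm
  · intro z; simp

theorem Circle.ofUnits_conj (z : ℂˣ) :
    Circle.ofUnits (Units.map (starRingEnd ℂ).toMonoidHom z) = (Circle.ofUnits z)⁻¹ := by
  ext
  rw [Circle.coe_inv_eq_conj, Circle.coe_ofUnits, Circle.coe_ofUnits]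
  simp

theorem Complex.continuous_log_norm_units :
    Continuous (fun z : ℂˣ => Real.log ‖(z : ℂ)‖) :=
  Units.continuous_val.norm.log fun z => by simp

namespace Hecke

/-- The character `z ↦ (z / |z|) ^ k * |z| ^ (i φ)` of `ℂˣ`. -/
noncomputable def archCharacter (k : ℤ) (φ : ℝ) : ℂˣ →* Circle where
  toFun z := Circle.ofUnits z ^ k * Circle.exp (φ * Real.log ‖(z : ℂ)‖)
  map_one' := by simp
  map_mul' x y := by
    have : Real.log ‖((x * y : ℂˣ) : ℂ)‖ = Real.log ‖(x : ℂ)‖ + Real.log ‖(y : ℂ)‖ := by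
      simp [Real.log_mul]
    rw [this, mul_add, Circle.exp_add, map_mul, mul_zpow]
    exact mul_mul_mul_comm _ _ _ _

theorem archCharacter_apply (k : ℤ) (φ : ℝ) (z : ℂˣ) :
    archCharacter k φ z = Circle.ofUnits z ^ k * Circle.exp (φ * Real.log ‖(z : ℂ)‖) := rfl

theorem continuous_archCharacter (k : ℤ) (φ : ℝ) : Continuous (archCharacter k φ) :=
  (Circle.continuous_ofUnits.zpow k).mul
    (Circle.exp.continuous.comp (continuous_const.mul Complex.continuous_log_norm_units))

theorem archCharacter_zero (z : ℂˣ) : archCharacter 0 0 z = 1 := by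
  simp [archCharacter_apply]

theorem archCharacter_add (k l : ℤ) (φ ψ : ℝ) (z : ℂˣ) :
    archCharacter (k + l) (φ + ψ) z = archCharacter k φ z * archCharacter l ψ z := by
  simp only [archCharacter_apply, zpow_add, add_mul, Circle.exp_add]
  exact mul_mul_mul_comm _ _ _ _

theorem archCharacter_zsmul (n k : ℤ) (φ : ℝ) (z : ℂˣ) :
    archCharacter (n * k) (n * φ) z = archCharacter k φ z ^ n := by
  simp only [archCharacter_apply, mul_zpow, mul_assoc, Circle.exp_intCast_mul]
  rw [mul_comm n k, zpow_mul]

theorem archCharacter_conj (k : ℤ) (φ : ℝ) (z : ℂˣ) :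
    archCharacter k φ (Units.map (starRingEnd ℂ).toMonoidHom z) = archCharacter (-k) φ z := by
  rw [archCharacter_apply, archCharacter_apply, Circle.ofUnits_conj, inv_zpow', Units.coe_map]
  simp

theorem archCharacter_coe (k : ℤ) (φ : ℝ) (n : ℕ) (z : ℂˣ) :
    (archCharacter k (n * φ) z : ℂ) =
      ((z : ℂ) / ‖(z : ℂ)‖) ^ k * ((‖(z : ℂ)‖ ^ n : ℝ) : ℂ) ^ ((φ : ℂ) * Complex.I) := by
  have hz : 0 < ‖(z : ℂ)‖ := by simp
  rw [archCharacter_apply, Circle.coe_mul, Circle.coe_zpow, Circle.coe_ofUnits, Circle.coe_exp,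
    Complex.cpow_def_of_ne_zero (by exact_mod_cast (pow_pos hz n).ne'), ← Complex.ofReal_log
    (pow_pos hz n).le, Real.log_pow]
  congr 2
  push_cast
  ring

/-! ### Extension of characters of the idèle group -/

/-- A homomorphism to the circle that is defined on the subgroup `U` and agrees with the trivial
homomorphism on `U ⊓ P` extends to a homomorphism of the whole group that is trivial on `P`. -/
theorem exists_extension_to_circle {A : Type*} [CommGroup A] (U P : Subgroup A) (f : A →* Circle)
    (h : ∀ x ∈ U, x ∈ P → f x = 1) :
    ∃ g : A ⧸ P →* Circle, ∀ x ∈ U, g (QuotientGroup.mk x) = f x := by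
  let q : U →* A ⧸ P := (QuotientGroup.mk' P).comp U.subtype
  have hker : q.ker ≤ (f.comp U.subtype).ker := by
    intro x hx
    rw [MonoidHom.mem_ker] at hx ⊢
    exact h x x.2 ((QuotientGroup.eq_one_iff (N := P) (x : A)).mp hx)
  let f' : U ⧸ q.ker →* Circle := QuotientGroup.lift q.ker (f.comp U.subtype) hker
  have hdiv : DivisibleBy (Additive Circle) ℤ := by
    refine AddCommGroup.divisibleByIntOfSMulTopEqTop _ fun {n} hn => ?_
    refine top_unique fun x _ => ?_
    obtain ⟨t, ht⟩ := Circle.exp_surjective x.toMul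
    refine ⟨Additive.ofMul (Circle.exp (t / n)), trivial, ?_⟩
    change Additive.ofMul (Circle.exp (t / n) ^ n) = x
    rw [← Circle.exp_intCast_mul, mul_div_cancel₀ _ (by exact_mod_cast hn), ht]
    rfl
  obtain ⟨g, hg⟩ := (Module.Baer.of_divisible (Additive Circle)).extension_property_addMonoidHom
    (MonoidHom.toAdditive (QuotientGroup.kerLift q))
    (fun a b hab => QuotientGroup.kerLift_injective q hab) (MonoidHom.toAdditive f')
  refine ⟨MonoidHom.toAdditive.symm g, fun x hx => ?_⟩
  exact congrArg Additive.toMul (DFunLike.congr_fun hg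
    (Additive.ofMul (QuotientGroup.mk (⟨x, hx⟩ : U) : U ⧸ q.ker)))

universe u
variable {F : Type u} [Field F] [NumberField F]

/-- The idèles all of whose finite components are units. -/
def unitIdeles (F : Type u) [Field F] [NumberField F] : Subgroup (Idele F) where
  carrier := {x | ∀ v : HeightOneSpectrum (𝓞 F), Valued.v (finComponent v x) = 1}
  one_mem' := fun v => by rw [finComponent_one, map_one]
  mul_mem' := fun hx hy v => by rw [finComponent_mul, map_mul, hx v, hy v, one_mul]
  inv_mem' := fun {x} hx v => by
    have e : finComponent v x * finComponent v x⁻¹ = 1 := by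
      rw [← finComponent_mul, mul_inv_cancel, finComponent_one]
    have := congrArg Valued.v e
    rwa [map_mul, hx v, one_mul, map_one] at this

theorem mem_unitIdeles {x : Idele F} :
    x ∈ unitIdeles F ↔ ∀ v : HeightOneSpectrum (𝓞 F), Valued.v (finComponent v x) = 1 := Iff.rfl

theorem isOpen_unitIdeles : IsOpen (unitIdeles F : Set (Idele F)) := by
  have ho : IsOpen {a : FiniteAdeleRing (𝓞 F) F | ∀ v, a v ∈ v.adicCompletionIntegers F} := by
    exact RestrictedProduct.isOpen_forall_mem
      (R := fun v : HeightOneSpectrum (𝓞 F) => v.adicCompletion F)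
      (A := fun v : HeightOneSpectrum (𝓞 F) => (v.adicCompletionIntegers F : Set _))
      fun v => Valued.isOpen_valuationSubring _
  have h1 : Continuous fun x : Idele F => (x : AdeleRing (𝓞 F) F).2 :=
    continuous_snd.comp Units.continuous_val
  have h2 : Continuous fun x : Idele F => ((x⁻¹ : Idele F) : AdeleRing (𝓞 F) F).2 :=
    continuous_snd.comp Units.continuous_coe_inv
  convert (ho.preimage h1).inter (ho.preimage h2) using 1
  ext x
  have key : ∀ (y : Idele F) (v : HeightOneSpectrum (𝓞 F)),
      ((y : AdeleRing (𝓞 F) F).2 v ∈ v.adicCompletionIntegers F ↔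
        Valued.v (finComponent v y) ≤ 1) := fun y v => Iff.rfl
  simp only [SetLike.mem_coe, mem_unitIdeles, Set.mem_inter_iff, Set.mem_preimage,
    Set.mem_ofPred_eq, key]
  constructor
  · intro hx
    exact ⟨fun v => (hx v).le, fun v => (mem_unitIdeles.mp ((unitIdeles F).inv_mem hx) v).le⟩
  · rintro ⟨hx, hx'⟩ v
    refine le_antisymm (hx v) ?_
    have e : finComponent v x * finComponent v x⁻¹ = 1 := by
      rw [← finComponent_mul, mul_inv_cancel, finComponent_one]
    have e' := congrArg Valued.v e
    rw [map_mul, map_one] at e'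
    rw [← e']
    exact mul_le_of_le_one_right' (hx' v)

/-- The image of the component at `w` under the embedding of the completion into `ℂ`. -/
noncomputable def infEmbedding (w : InfinitePlace F) : Idele F →* ℂˣ :=
  Units.map ((InfinitePlace.Completion.extensionEmbedding w).toMonoidHom.comp
    ((Pi.evalMonoidHom (fun w : InfinitePlace F => w.Completion) w).comp
      (MonoidHom.fst (InfiniteAdeleRing F) (FiniteAdeleRing (𝓞 F) F))))

theorem coe_infEmbedding (w : InfinitePlace F) (x : Idele F) :
    (infEmbedding w x : ℂ) =
      InfinitePlace.Completion.extensionEmbedding w (infComponent w x) := rfl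

theorem continuous_infEmbedding (w : InfinitePlace F) : Continuous (infEmbedding w) := by
  refine Continuous.units_map _ ?_
  exact (InfinitePlace.Completion.isometry_extensionEmbedding w).continuous.comp
    ((continuous_apply w).comp continuous_fst)

theorem exists_unit_of_mem_principalIdeles {x : Idele F} (hx : x ∈ unitIdeles F)
    (hx' : x ∈ principalIdeles F) :
    ∃ u : (𝓞 F)ˣ, ∀ w : InfinitePlace F, (infEmbedding w x : ℂ) = w.embedding (u : F) := by
  obtain ⟨a, rfl⟩ := hx'
  have hv : ∀ v : HeightOneSpectrum (𝓞 F), v.valuation F (a : F) = 1 := by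
    intro v
    have := mem_unitIdeles.mp hx v
    rwa [← HeightOneSpectrum.valuedAdicCompletion_eq_valuation']
  have hv' : ∀ v : HeightOneSpectrum (𝓞 F), v.valuation F ((a⁻¹ : Fˣ) : F) = 1 := by
    intro v
    rw [Units.val_inv_eq_inv_val, map_inv₀, hv v, inv_one]
  obtain ⟨b, hb⟩ := HeightOneSpectrum.mem_integers_of_valuation_le_one F (a : F)
    fun v => (hv v).le
  obtain ⟨b', hb'⟩ := HeightOneSpectrum.mem_integers_of_valuation_le_one F ((a⁻¹ : Fˣ) : F)
    fun v => (hv' v).le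
  have hbb : b * b' = 1 := by
    apply FaithfulSMul.algebraMap_injective (𝓞 F) F
    rw [map_mul, hb, hb', map_one, Units.mul_inv]
  refine ⟨⟨b, b', hbb, by rw [mul_comm, hbb]⟩, fun w => ?_⟩
  rw [coe_infEmbedding]
  change InfinitePlace.Completion.extensionEmbedding w (((a : F) : w.Completion)) = _
  rw [InfinitePlace.Completion.extensionEmbedding_coe]
  exact congrArg w.embedding hb.symm

/-- The map on units of the ring of integers induced by a complex embedding. -/
def unitsEmbedding (σ : F →+* ℂ) : (𝓞 F)ˣ →* ℂˣ :=
  Units.map (σ.comp (algebraMap (𝓞 F) F)).toMonoidHom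

@[simp]
theorem coe_unitsEmbedding (σ : F →+* ℂ) (u : (𝓞 F)ˣ) :
    (unitsEmbedding σ u : ℂ) = σ (u : F) := rfl

/-- A variant of `HasLocalParameters` in terms of characters of `ℂˣ`, with trivial sign
characters at the real places. -/
def HasArchParameters (χ : HeckeCharacter F) (w : InfinitePlace F) (k : ℤ) (φ : ℝ) : Prop :=
  (w.IsReal → k = 0) ∧ ∀ x : w.Completionˣ, localComponent χ w x =
    archCharacter k (w.mult * φ)
      (Units.map (InfinitePlace.Completion.extensionEmbedding w).toMonoidHom x)

theorem HasArchParameters.hasLocalParameters {χ : HeckeCharacter F} {w : InfinitePlace F} {k : ℤ}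
    {φ : ℝ} (h : HasArchParameters χ w k φ) : HasLocalParameters χ w k φ := by
  refine ⟨fun hw => Or.inl (h.1 hw), fun x => ?_⟩
  rw [h.2 x, archCharacter_coe, ← (InfinitePlace.Completion.isometry_extensionEmbedding
    w).norm_map_of_map_zero (map_zero _) (x : w.Completion)]
  rfl

theorem localComponent_mul (χ ψ : HeckeCharacter F) (w : InfinitePlace F) (x : w.Completionˣ) :
    localComponent (χ * ψ) w x = localComponent χ w x * localComponent ψ w x := rfl

theorem localComponent_inv (χ : HeckeCharacter F) (w : InfinitePlace F) (x : w.Completionˣ) :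
    localComponent χ⁻¹ w x = (localComponent χ w x)⁻¹ := rfl

theorem hasArchParameters_one (w : InfinitePlace F) :
    HasArchParameters (1 : HeckeCharacter F) w 0 0 := by
  refine ⟨fun _ => rfl, fun x => ?_⟩
  rw [mul_zero, archCharacter_zero]
  rfl

theorem HasArchParameters.mul {χ ψ : HeckeCharacter F} {w : InfinitePlace F} {k l : ℤ} {φ θ : ℝ}
    (h : HasArchParameters χ w k φ) (h' : HasArchParameters ψ w l θ) :
    HasArchParameters (χ * ψ) w (k + l) (φ + θ) := by
  refine ⟨fun hw => by rw [h.1 hw, h'.1 hw, add_zero], fun x => ?_⟩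
  rw [localComponent_mul, h.2, h'.2, mul_add, archCharacter_add]

theorem HasArchParameters.inv {χ : HeckeCharacter F} {w : InfinitePlace F} {k : ℤ} {φ : ℝ}
    (h : HasArchParameters χ w k φ) : HasArchParameters χ⁻¹ w (-k) (-φ) := by
  refine ⟨fun hw => by rw [h.1 hw, neg_zero], fun x => ?_⟩
  rw [localComponent_inv, h.2, inv_eq_iff_mul_eq_one, ← archCharacter_add, mul_neg,
    add_neg_cancel, add_neg_cancel, archCharacter_zero]

theorem HasArchParameters.zpow {χ : HeckeCharacter F} {w : InfinitePlace F} {k : ℤ} {φ : ℝ}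
    (h : HasArchParameters χ w k φ) (n : ℤ) : HasArchParameters (χ ^ n) w (n * k) (n * φ) := by
  induction n with
  | zero => simpa using hasArchParameters_one w
  | succ n ih =>
    convert ih.mul h using 1
    · rw [zpow_add_one]
    · ring
    · push_cast; ring
  | pred n ih =>
    convert ih.mul h.inv using 1
    · rw [zpow_sub_one]
    · ring
    · push_cast; ring

theorem HasArchParameters.prod {ι : Type*} (s : Finset ι) {χ : ι → HeckeCharacter F}
    {w : InfinitePlace F} {k : ι → ℤ} {φ : ι → ℝ}
    (h : ∀ i ∈ s, HasArchParameters (χ i) w (k i) (φ i)) :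
    HasArchParameters (∏ i ∈ s, χ i) w (∑ i ∈ s, k i) (∑ i ∈ s, φ i) := by
  classical
  induction s using Finset.induction_on with
  | empty => simpa using hasArchParameters_one w
  | insert a s ha ih =>
    rw [Finset.prod_insert ha, Finset.sum_insert ha, Finset.sum_insert ha]
    exact (h a (Finset.mem_insert_self a s)).mul
      (ih fun i hi => h i (Finset.mem_insert_of_mem hi))

theorem infEmbedding_localEmbedding_same (w : InfinitePlace F) (x : w.Completionˣ) :
    infEmbedding w (localEmbedding w x) =
      Units.map (InfinitePlace.Completion.extensionEmbedding w).toMonoidHom x := by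
  ext
  rw [coe_infEmbedding, infComponent_localEmbedding_same]
  rfl

theorem infEmbedding_localEmbedding_of_ne {w w' : InfinitePlace F} (h : w' ≠ w)
    (x : w.Completionˣ) : infEmbedding w' (localEmbedding w x) = 1 := by
  ext
  rw [coe_infEmbedding, infComponent_localEmbedding_of_ne h, map_one, Units.val_one]

/-- A character of the archimedean part of the idèle group that is trivial on the global units
is the archimedean part of an unramified Hecke character. -/
theorem exists_heckeCharacter (k : InfinitePlace F → ℤ) (φ : InfinitePlace F → ℝ)
    (hk : ∀ w : InfinitePlace F, w.IsReal → k w = 0)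
    (hu : ∀ u : (𝓞 F)ˣ,
      ∏ w : InfinitePlace F, archCharacter (k w) (w.mult * φ w) (unitsEmbedding w.embedding u) = 1) :
    ∃ χ : HeckeCharacter F, (∀ m : Modulus F, χ ∈ characterGroup m) ∧
      ∀ w : InfinitePlace F, HasArchParameters χ w (k w) (φ w) := by
  classical
  let f : Idele F →* Circle :=
    ∏ w : InfinitePlace F, (archCharacter (k w) (w.mult * φ w)).comp (infEmbedding w)
  have hf : ∀ x, f x = ∏ w : InfinitePlace F,
      archCharacter (k w) (w.mult * φ w) (infEmbedding w x) := fun x => by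
    simp [f, MonoidHom.finsetProd_apply]
  have hfc : Continuous f := by
    have : (f : Idele F → Circle) = fun x => ∏ w : InfinitePlace F,
      archCharacter (k w) (w.mult * φ w) (infEmbedding w x) := funext hf
    rw [this]
    exact continuous_finsetProd _ fun w _ =>
      (continuous_archCharacter _ _).comp (continuous_infEmbedding w)
  obtain ⟨g, hg⟩ := exists_extension_to_circle (unitIdeles F) (principalIdeles F) f (by
    intro x hx hx'
    obtain ⟨u, hu'⟩ := exists_unit_of_mem_principalIdeles hx hx'
    rw [hf, ← hu u]
    refine Finset.prod_congr rfl fun w _ => ?_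
    congr 1
    ext
    rw [hu' w, coe_unitsEmbedding])
  have hgc : Continuous g := by
    refine (QuotientGroup.isOpenQuotientMap_mk (N := principalIdeles F)).isQuotientMap.continuous_iff.mpr ?_
    refine continuous_of_continuousAt_one (g.comp (QuotientGroup.mk' (principalIdeles F))) ?_
    refine hfc.continuousAt.congr ?_
    filter_upwards [isOpen_unitIdeles.mem_nhds (unitIdeles F).one_mem] with x hx
    exact (hg x hx).symm
  let χ : HeckeCharacter F := (⟨g, hgc⟩ : IdeleClassGroup F →ₜ* Circle)
  have hχ : ∀ x ∈ unitIdeles F, χ (QuotientGroup.mk x) = f x := hg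
  refine ⟨χ, fun m x hx => ?_, fun w => ⟨hk w, fun x => ?_⟩⟩
  · rw [hχ x (fun v => (hx.1 v).1), hf]
    refine Finset.prod_eq_one fun w _ => ?_
    rcases hx.2 w with h | ⟨hw, -, h⟩
    · have : infEmbedding w x = 1 := by
        ext
        rw [coe_infEmbedding, h, map_one, Units.val_one]
      rw [this, map_one]
    · have : ‖(infEmbedding w x : ℂ)‖ = 1 := by
        rw [coe_infEmbedding, h, map_neg, map_one, norm_neg, norm_one]
      rw [archCharacter_apply, hk w hw, this]
      simp
  · rw [localComponent, hχ _ (fun v => by rw [finComponent_localEmbedding, map_one]), hf,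
      Finset.prod_eq_single w, infEmbedding_localEmbedding_same]
    · intro w' _ hw'
      rw [infEmbedding_localEmbedding_of_ne hw', map_one]
    · simp

theorem HasLocalParameters.phi_unique {χ : HeckeCharacter F} {w : InfinitePlace F} {k l : ℤ}
    {φ ψ : ℝ} (h : HasLocalParameters χ w k φ) (h' : HasLocalParameters χ w l ψ) : φ = ψ := by
  have key : ∀ n : ℕ, 1 ≤ n → Circle.exp ((φ - ψ) * (w.mult * Real.log n)) = 1 := by
    intro n hn
    have hn0 : (n : w.Completion) ≠ 0 := by
      intro h0
      have := congrArg (InfinitePlace.Completion.extensionEmbedding w) h0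
      rw [map_natCast, map_zero] at this
      have : n = 0 := by exact_mod_cast this
      omega
    let x : w.Completionˣ := Units.mk0 _ hn0
    have hx : InfinitePlace.Completion.extensionEmbedding w (x : w.Completion) = n := by
      simp [x]
    have hx' : ‖(x : w.Completion)‖ = n := by
      rw [← (InfinitePlace.Completion.isometry_extensionEmbedding w).norm_map_of_map_zero
          (map_zero _), hx]
      simp
    have hnR : (0 : ℝ) < n := by exact_mod_cast hn
    have hnC : (n : ℂ) ≠ 0 := by exact_mod_cast hnR.ne'
    have e := (h.2 x).symm.trans (h'.2 x)
    have e1 : ∀ θ : ℝ, (((n : ℝ) ^ w.mult : ℝ) : ℂ) ^ ((θ : ℂ) * Complex.I) =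
        (Circle.exp (θ * (w.mult * Real.log n)) : ℂ) := by
      intro θ
      rw [Complex.cpow_def_of_ne_zero (by exact_mod_cast (pow_pos hnR _).ne'),
        ← Complex.ofReal_log (pow_pos hnR _).le, Real.log_pow, Circle.coe_exp]
      congr 1
      push_cast
      ring
    have hdiv : (n : ℂ) / (‖(n : ℂ)‖ : ℂ) = 1 := by
      rw [Complex.norm_natCast]
      exact div_self (by exact_mod_cast hnR.ne')
    rw [hx, hx', hdiv, one_zpow, one_zpow, one_mul, one_mul, e1, e1] at e
    rw [sub_mul, Circle.exp_sub, Circle.ext e, div_self']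
  by_contra hne
  set c : ℝ := (φ - ψ) * w.mult with hc
  have hc0 : c ≠ 0 := mul_ne_zero (sub_ne_zero.mpr hne) (by exact_mod_cast w.mult_pos.ne')
  have key' : ∀ n : ℕ, 1 ≤ n → ∃ a : ℤ, c * Real.log n = a * (2 * Real.pi) := by
    intro n hn
    obtain ⟨a, ha⟩ := Circle.exp_eq_one.mp (key n hn)
    exact ⟨a, by rw [← ha, hc]; ring⟩
  have hlim : Filter.Tendsto (fun n : ℕ => c * (Real.log (n + 1 : ℕ) - Real.log n))
      Filter.atTop (nhds 0) := by
    have := (Real.tendsto_log_nat_add_one_sub_log).const_mul c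
    simpa using this
  have hpi : (0 : ℝ) < 2 * Real.pi := by positivity
  obtain ⟨n, hn, hn1⟩ := ((hlim.eventually (Metric.ball_mem_nhds 0 hpi)).and
    (Filter.eventually_ge_atTop 1)).exists
  obtain ⟨a, ha⟩ := key' n hn1
  obtain ⟨b, hb⟩ := key' (n + 1) (by omega)
  rw [mul_sub, ha, hb, dist_zero_right, ← sub_mul, norm_mul,
    Real.norm_of_nonneg hpi.le, mul_lt_iff_lt_one_left hpi] at hn
  have hab : b = a := by
    have : |b - a| < 1 := by
      have h1 : ‖(b : ℝ) - a‖ = ((|b - a| : ℤ) : ℝ) := by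
        push_cast
        rfl
      rw [h1] at hn
      exact_mod_cast hn
    rw [Int.abs_lt_one_iff] at this
    omega
  have hz : c * (Real.log (n + 1 : ℕ) - Real.log n) = 0 := by
    rw [mul_sub, ha, hb, hab, sub_self]
  have hlt : Real.log n < Real.log (n + 1 : ℕ) :=
    Real.log_lt_log (by exact_mod_cast hn1) (by exact_mod_cast Nat.lt_succ_self n)
  exact (mul_ne_zero hc0 (sub_pos.mpr hlt).ne') hz

theorem HasPhi.unique {χ : HeckeCharacter F} {w : InfinitePlace F} {φ ψ : ℝ}
    (h : HasPhi χ w φ) (h' : HasPhi χ w ψ) : φ = ψ := by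
  obtain ⟨k, hk⟩ := h
  obtain ⟨l, hl⟩ := h'
  exact hk.phi_unique hl

theorem isAlmostAlgebraic_one : IsAlmostAlgebraic (1 : HeckeCharacter F) :=
  fun w => ⟨0, (hasArchParameters_one w).hasLocalParameters⟩

open ComplexEmbedding in
@[to_additive]
theorem prod_complexEmbedding {M : Type*} [CommMonoid M] (f : (F →+* ℂ) → M) (g : InfinitePlace F → M)
    (hr : ∀ w : InfinitePlace F, w.IsReal → f w.embedding = g w)
    (hc : ∀ w : InfinitePlace F, w.IsComplex →
      f w.embedding * f (conjugate w.embedding) = g w) :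
    ∏ σ, f σ = ∏ w, g w := by
  classical
  rw [← Finset.prod_fiberwise Finset.univ (InfinitePlace.mk : (F →+* ℂ) → InfinitePlace F) f]
  refine Finset.prod_congr rfl fun w _ => ?_
  have hfilter : (Finset.univ.filter fun σ : F →+* ℂ => InfinitePlace.mk σ = w) =
      {w.embedding, conjugate w.embedding} := by
    ext σ
    rw [Finset.mem_filter, Finset.mem_insert, Finset.mem_singleton]
    conv_lhs => rw [← InfinitePlace.mk_embedding w]
    rw [InfinitePlace.mk_eq_iff]
    constructor
    · rintro ⟨-, h | h⟩
      · exact Or.inl h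
      · exact Or.inr (by rw [← h]; simp)
    · rintro (h | h)
      · exact ⟨Finset.mem_univ _, Or.inl h⟩
      · exact ⟨Finset.mem_univ _, Or.inr (by rw [h]; simp)⟩
  rw [hfilter]
  rcases w.isReal_or_isComplex with hw | hw
  · have : conjugate w.embedding = w.embedding := by
      rw [← isReal_iff]
      exact InfinitePlace.isReal_iff.mp hw
    rw [this, Finset.pair_eq_singleton, Finset.prod_singleton, hr w hw]
  · have : w.embedding ≠ conjugate w.embedding := by
      intro h
      refine InfinitePlace.isComplex_iff.mp hw ?_
      rw [isReal_iff]
      exact h.symm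
    rw [Finset.prod_pair this, hc w hw]

theorem unitsEmbedding_conjugate (σ : F →+* ℂ) (u : (𝓞 F)ˣ) :
    unitsEmbedding (ComplexEmbedding.conjugate σ) u =
      Units.map (starRingEnd ℂ).toMonoidHom (unitsEmbedding σ u) := by
  ext
  rfl

/-- The value of the archimedean character with parameters `k` and `φ` on a global unit. -/
noncomputable def unitCharacter (k : (F →+* ℂ) → ℤ) (φ : (F →+* ℂ) → ℝ) (u : (𝓞 F)ˣ) : Circle :=
  ∏ σ, archCharacter (k σ) (φ σ) (unitsEmbedding σ u)

theorem unitCharacter_eq_prod_place {k : (F →+* ℂ) → ℤ} {φ : (F →+* ℂ) → ℝ}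
    (hk : ∀ σ, k (ComplexEmbedding.conjugate σ) = -k σ)
    (hφ : ∀ σ, φ (ComplexEmbedding.conjugate σ) = φ σ) (u : (𝓞 F)ˣ) :
    unitCharacter k φ u = ∏ w : InfinitePlace F,
      archCharacter (2 * k w.embedding) (w.mult * φ w.embedding) (unitsEmbedding w.embedding u) := by
  refine prod_complexEmbedding _ _ (fun w hw => ?_) (fun w hw => ?_)
  · have h : k w.embedding = 0 := by
      have h1 : ComplexEmbedding.conjugate w.embedding = w.embedding :=
        ComplexEmbedding.isReal_iff.mp (InfinitePlace.isReal_iff.mp hw)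
      have h2 := hk w.embedding
      rw [h1] at h2
      omega
    rw [h, InfinitePlace.mult, if_pos hw]
    simp
  · rw [hk, hφ, unitsEmbedding_conjugate, archCharacter_conj, neg_neg, ← archCharacter_add,
      InfinitePlace.mult, if_neg (InfinitePlace.not_isReal_iff_isComplex.mpr hw), two_mul]
    congr 2
    push_cast
    ring

/-- The existence of Hecke characters with prescribed archimedean parameters, indexed by the
complex embeddings. -/
theorem exists_heckeCharacter_of_unitCharacter {k : (F →+* ℂ) → ℤ} {φ : (F →+* ℂ) → ℝ}
    (hk : ∀ σ, k (ComplexEmbedding.conjugate σ) = -k σ)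
    (hφ : ∀ σ, φ (ComplexEmbedding.conjugate σ) = φ σ)
    (h : ∀ u : (𝓞 F)ˣ, unitCharacter k φ u = 1) :
    ∃ χ : HeckeCharacter F, (∀ m : Modulus F, χ ∈ characterGroup m) ∧
      ∀ w : InfinitePlace F, HasArchParameters χ w (2 * k w.embedding) (φ w.embedding) := by
  refine exists_heckeCharacter _ _ (fun w hw => ?_) fun u => ?_
  · have h1 : ComplexEmbedding.conjugate w.embedding = w.embedding :=
      ComplexEmbedding.isReal_iff.mp (InfinitePlace.isReal_iff.mp hw)
    have h2 := hk w.embedding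
    rw [h1] at h2
    omega
  · rw [← unitCharacter_eq_prod_place hk hφ, h u]

theorem unitCharacter_add (k l : (F →+* ℂ) → ℤ) (φ ψ : (F →+* ℂ) → ℝ) (u : (𝓞 F)ˣ) :
    unitCharacter (k + l) (φ + ψ) u = unitCharacter k φ u * unitCharacter l ψ u := by
  simp only [unitCharacter, Pi.add_apply, archCharacter_add, Finset.prod_mul_distrib]

theorem unitCharacter_zero (u : (𝓞 F)ˣ) :
    unitCharacter (0 : (F →+* ℂ) → ℤ) 0 u = 1 := by
  simp [unitCharacter, archCharacter_zero]

theorem unitCharacter_zsmul (n : ℤ) (k : (F →+* ℂ) → ℤ) (φ : (F →+* ℂ) → ℝ) (u : (𝓞 F)ˣ) :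
    unitCharacter (n • k) (n • φ) u = unitCharacter k φ u ^ n := by
  simp only [unitCharacter, Pi.smul_apply, zsmul_eq_mul, Int.cast_id, archCharacter_zsmul,
    Finset.prod_zpow]

theorem unitCharacter_mul (k : (F →+* ℂ) → ℤ) (φ : (F →+* ℂ) → ℝ) (u v : (𝓞 F)ˣ) :
    unitCharacter k φ (u * v) = unitCharacter k φ u * unitCharacter k φ v := by
  simp only [unitCharacter, map_mul, Finset.prod_mul_distrib]

/-- The pairing between functions on the set of complex embeddings and units that is given by the
logarithms of the absolute values. -/
noncomputable def logPairing (F : Type u) [Field F] [NumberField F] :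
    ((F →+* ℂ) → ℝ) →ₗ[ℝ] (Additive (𝓞 F)ˣ →+ ℝ) where
  toFun φ :=
    { toFun := fun u => ∑ σ, φ σ * Real.log ‖σ (u.toMul : F)‖
      map_zero' := by simp
      map_add' := fun u v => by
        rw [← Finset.sum_add_distrib]
        refine Finset.sum_congr rfl fun σ _ => ?_
        rw [← mul_add, ← Real.log_mul (by simp) (by simp), ← norm_mul, ← map_mul]
        rfl }
  map_add' φ ψ := by
    ext u
    simp [add_mul, Finset.sum_add_distrib]
  map_smul' r φ := by
    ext u
    simp [mul_assoc, Finset.mul_sum]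

theorem logPairing_apply (φ : (F →+* ℂ) → ℝ) (u : (𝓞 F)ˣ) :
    logPairing F φ (Additive.ofMul u) = ∑ σ, φ σ * Real.log ‖σ (u : F)‖ := rfl

theorem unitCharacter_zero_left (φ : (F →+* ℂ) → ℝ) (u : (𝓞 F)ˣ) :
    unitCharacter 0 φ u = Circle.exp (logPairing F φ (Additive.ofMul u)) := by
  rw [logPairing_apply, unitCharacter]
  have : ∀ s : Finset (F →+* ℂ), ∏ σ ∈ s, archCharacter ((0 : (F →+* ℂ) → ℤ) σ) (φ σ)
      (unitsEmbedding σ u) = Circle.exp (∑ σ ∈ s, φ σ * Real.log ‖σ (u : F)‖) := by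
    classical
    intro s
    induction s using Finset.induction_on with
    | empty => simp
    | insert a s ha ih =>
      rw [Finset.prod_insert ha, Finset.sum_insert ha, Circle.exp_add, ih, archCharacter_apply]
      simp
  exact this Finset.univ

theorem unitCharacter_eq_mul_exp (k : (F →+* ℂ) → ℤ) (φ : (F →+* ℂ) → ℝ) (u : (𝓞 F)ˣ) :
    unitCharacter k φ u =
      unitCharacter k 0 u * Circle.exp (logPairing F φ (Additive.ofMul u)) := by
  rw [← unitCharacter_zero_left, ← unitCharacter_add, add_zero, zero_add]

theorem logPairing_comp_mk (g : InfinitePlace F → ℝ) (u : (𝓞 F)ˣ) :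
    logPairing F (fun σ => g (InfinitePlace.mk σ)) (Additive.ofMul u) =
      ∑ w : InfinitePlace F, g w * (w.mult * Real.log (w (u : F))) := by
  rw [logPairing_apply]
  refine sum_complexEmbedding _ _ (fun w hw => ?_) (fun w hw => ?_)
  · rw [InfinitePlace.mk_embedding, InfinitePlace.norm_embedding_eq, InfinitePlace.mult, if_pos hw]
    simp
  · rw [InfinitePlace.mk_conjugate_eq, InfinitePlace.mk_embedding,
      ComplexEmbedding.conjugate_coe_eq, RCLike.norm_conj,
      InfinitePlace.norm_embedding_eq, InfinitePlace.mult,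
      if_neg (InfinitePlace.not_isReal_iff_isComplex.mpr hw)]
    push_cast
    ring

theorem logPairing_const (t : ℝ) : logPairing F (fun _ => t) = 0 := by
  refine AddMonoidHom.ext fun u => ?_
  have := logPairing_comp_mk (fun _ => t) u.toMul
  rw [← Finset.mul_sum, Units.sum_mult_mul_log, mul_zero] at this
  exact this

theorem addMonoidHom_eq_zero_of_mem_torsion (h : Additive (𝓞 F)ˣ →+ ℝ) {u : (𝓞 F)ˣ}
    (hu : u ∈ Units.torsion F) : h (Additive.ofMul u) = 0 := by
  obtain ⟨n, hn, hn'⟩ := isOfFinOrder_iff_pow_eq_one.mp ((CommGroup.mem_torsion (g := u)).mp hu)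
  have : n • h (Additive.ofMul u) = 0 := by
    rw [← map_nsmul, ← ofMul_pow, hn', ofMul_one, map_zero]
  simpa [hn.ne'] using this

open Units Units.dirichletUnitTheorem in
/-- Every real-valued homomorphism on the group of units is a linear combination of the logarithms
of the absolute values. -/
theorem exists_logPairing_eq (h : Additive (𝓞 F)ˣ →+ ℝ) :
    ∃ φ : (F →+* ℂ) → ℝ, (∀ σ, φ (ComplexEmbedding.conjugate σ) = φ σ) ∧ logPairing F φ = h := by
  classical
  let b := (basisUnitLattice F).ofZLatticeBasis ℝ (unitLattice F)
  let l : logSpace F →ₗ[ℝ] ℝ := b.constr ℝ fun i => h (Additive.ofMul (fundSystem F i))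
  have hl : ∀ i, l (logEmbedding F (Additive.ofMul (fundSystem F i))) =
      h (Additive.ofMul (fundSystem F i)) := by
    intro i
    rw [logEmbedding_fundSystem, ← Module.Basis.ofZLatticeBasis_apply ℝ (unitLattice F)]
    exact b.constr_basis ℝ _ i
  have hl' : ∀ u : (𝓞 F)ˣ, l (logEmbedding F (Additive.ofMul u)) = h (Additive.ofMul u) := by
    intro u
    obtain ⟨⟨ζ, e⟩, he, -⟩ := exist_unique_eq_mul_prod F u
    have h1 : Additive.ofMul u = Additive.ofMul (ζ : (𝓞 F)ˣ) +
        ∑ i, e i • Additive.ofMul (fundSystem F i) := by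
      rw [he, ofMul_mul, ofMul_prod]
      simp only [ofMul_zpow]
    rw [h1, map_add, map_add, map_add, logEmbedding_eq_zero_iff.mpr ζ.2, map_zero,
      addMonoidHom_eq_zero_of_mem_torsion h ζ.2, map_sum, map_sum, map_sum]
    congr 1
    refine Finset.sum_congr rfl fun i _ => ?_
    rw [map_zsmul, map_zsmul, map_zsmul, hl]
  let g : InfinitePlace F → ℝ := fun w =>
    if hw : w ≠ w₀ then l (Pi.single (⟨w, hw⟩ : {w : InfinitePlace F // w ≠ w₀}) 1) else 0
  refine ⟨fun σ => g (InfinitePlace.mk σ), fun σ => ?_, ?_⟩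
  · simp only [InfinitePlace.mk_conjugate_eq]
  · refine AddMonoidHom.ext fun u => ?_
    change logPairing F (fun σ => g (InfinitePlace.mk σ)) (Additive.ofMul u.toMul) =
      h (Additive.ofMul u.toMul)
    rw [logPairing_comp_mk, ← hl', Fintype.sum_eq_add_sum_subtype_ne _ w₀]
    have h0 : g w₀ = 0 := by simp [g]
    rw [h0, zero_mul, zero_add, LinearMap.pi_apply_eq_sum_univ l]
    refine Finset.sum_congr rfl fun w _ => ?_
    rw [logEmbedding_component, _root_.smul_eq_mul, mul_comm]
    congr 1
    simp only [g, dif_pos w.2]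
    congr 1
    ext v
    simp [Pi.single_apply, eq_comm]

open Units Units.dirichletUnitTheorem in
/-- The only linear relations between the logarithms of the absolute values of the units are the
multiples of the product formula. -/
theorem exists_add_conjugate_eq_of_logPairing_eq_zero {a : (F →+* ℂ) → ℝ}
    (ha : logPairing F a = 0) :
    ∃ C : ℝ, ∀ σ, a σ + a (ComplexEmbedding.conjugate σ) = C := by
  classical
  let g : InfinitePlace F → ℝ := fun w => a w.embedding + a (ComplexEmbedding.conjugate w.embedding)
  have hg : ∀ σ, a σ + a (ComplexEmbedding.conjugate σ) = g (InfinitePlace.mk σ) := by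
    intro σ
    rcases InfinitePlace.embedding_mk_eq σ with h | h
    · simp only [g, h]
    · simp only [g, h]
      rw [add_comm, ComplexEmbedding.involutive_conjugate F σ]
  have h0 : ∀ u : (𝓞 F)ˣ, ∑ w : InfinitePlace F, g w * (w.mult * Real.log (w (u : F))) = 0 := by
    intro u
    rw [← logPairing_comp_mk]
    simp only [← hg]
    have h1 := DFunLike.congr_fun ha (Additive.ofMul u)
    rw [logPairing_apply, AddMonoidHom.zero_apply] at h1
    rw [logPairing_apply]
    simp only [add_mul, Finset.sum_add_distrib, h1, zero_add]
    rw [← h1, ← (Equiv.sum_comp (star_involutive.toPerm (star : (F →+* ℂ) → (F →+* ℂ)))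
      fun σ => a σ * Real.log ‖σ (u : F)‖)]
    refine Finset.sum_congr rfl fun σ _ => ?_
    congr 2
    exact (RCLike.norm_conj _).symm
  let l : logSpace F →ₗ[ℝ] ℝ := ∑ w : {w : InfinitePlace F // w ≠ w₀}, (g w - g w₀) •
    LinearMap.proj w
  have hl : l = 0 := by
    refine LinearMap.ext_on (s := (unitLattice F : Set (logSpace F)))
      (unitLattice_span_eq_top F) ?_
    rintro _ ⟨u, -, rfl⟩
    change l (logEmbedding F (Additive.ofMul u.toMul)) = 0
    have h1 := h0 u.toMul
    have h2 := congrArg (g w₀ * ·) (sum_logEmbedding_component u.toMul)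
    rw [Fintype.sum_eq_add_sum_subtype_ne _ w₀] at h1
    simp only [Finset.mul_sum] at h2
    simp only [l, LinearMap.sum_apply, LinearMap.smul_apply, LinearMap.proj_apply, _root_.smul_eq_mul,
      sub_mul, Finset.sum_sub_distrib, h2]
    simp only [logEmbedding_component]
    linarith
  refine ⟨g w₀, fun σ => ?_⟩
  rw [hg]
  by_cases hw : InfinitePlace.mk σ = w₀
  · rw [hw]
  · have := LinearMap.congr_fun hl
      (Pi.single (⟨InfinitePlace.mk σ, hw⟩ : {w : InfinitePlace F // w ≠ w₀}) 1)
    simp [l, Pi.single_apply] at this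
    linarith

end Hecke

theorem natCast_card_le_rank_int_of_mem_span {M V ι : Type*} [AddCommGroup M] [AddCommGroup V]
    [Module ℝ V] [Fintype ι] (T : M →ₗ[ℤ] V) {v : ι → V} (hv : LinearIndependent ℝ v)
    (hspan : ∀ i, v i ∈ Submodule.span ℝ (Set.range T)) :
    (Fintype.card ι : Cardinal) ≤ Module.rank ℤ M := by
  obtain ⟨b, hb, hbs, hbi⟩ := exists_linearIndependent ℝ (Set.range T)
  have h1 : LinearIndependent ℤ (Subtype.val : b → V) :=
    hbi.restrict_scalars (by
      intro m n h
      simpa using h)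
  choose g hg using fun x : b => hb x.2
  have h2 : LinearIndependent ℤ g := by
    refine LinearIndependent.of_comp T ?_
    have : T ∘ g = Subtype.val := funext hg
    rwa [this]
  have h3 := h2.cardinal_lift_le_rank
  let v' : ι → Submodule.span ℝ (Set.range T) := fun i => ⟨v i, hspan i⟩
  have h4 : LinearIndependent ℝ v' :=
    LinearIndependent.of_comp (Submodule.span ℝ (Set.range T)).subtype hv
  have h5 := h4.cardinal_lift_le_rank
  rw [← hbs, rank_span_set hbi, Cardinal.mk_fintype] at h5
  have h6 : (Fintype.card ι : Cardinal) ≤ Cardinal.mk b := by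
    simpa using h5
  have h7 := Cardinal.lift_le.mpr h6
  have h8 := h7.trans h3
  simpa using h8

namespace Hecke
universe u
variable {F : Type u} [Field F] [NumberField F]

/-- The map on units induced by a ring endomorphism of the field. -/
noncomputable def unitsMap (c : F →+* F) : (𝓞 F)ˣ →* (𝓞 F)ˣ :=
  Units.map (RingOfIntegers.mapRingHom c).toMonoidHom

/-- Precomposition with an involution of the field, as a permutation of the complex embeddings. -/
def compPerm {c : F →+* F} (hc : c.comp c = RingHom.id F) : Equiv.Perm (F →+* ℂ) :=
  Function.Involutive.toPerm (fun σ : F →+* ℂ => σ.comp c) fun σ => by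
    simp only [RingHom.comp_assoc, hc, RingHom.comp_id]

theorem logPairing_unitsMap {c : F →+* F} (hc : c.comp c = RingHom.id F) (φ : (F →+* ℂ) → ℝ)
    (u : (𝓞 F)ˣ) :
    logPairing F φ (Additive.ofMul (unitsMap c u)) =
      logPairing F (fun σ => φ (σ.comp c)) (Additive.ofMul u) := by
  rw [logPairing_apply, logPairing_apply, ← Equiv.sum_comp (compPerm hc)]
  refine Finset.sum_congr rfl fun σ _ => ?_
  change φ (σ.comp c) * Real.log ‖σ (c (c (u : F)))‖ = _
  rw [← RingHom.comp_apply c c, hc, RingHom.id_apply]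

theorem unitCharacter_unitsMap {c : F →+* F} (hc : c.comp c = RingHom.id F)
    (k : (F →+* ℂ) → ℤ) (φ : (F →+* ℂ) → ℝ) (u : (𝓞 F)ˣ) :
    unitCharacter k φ (unitsMap c u) =
      unitCharacter (fun σ => k (σ.comp c)) (fun σ => φ (σ.comp c)) u := by
  rw [unitCharacter, unitCharacter, ← Equiv.prod_comp (compPerm hc)]
  refine Finset.prod_congr rfl fun σ _ => ?_
  change archCharacter (k (σ.comp c)) (φ (σ.comp c))
    (unitsEmbedding (σ.comp c) (unitsMap c u)) = _
  congr 1
  ext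
  change σ (c (c (u : F))) = σ u
  rw [← RingHom.comp_apply c c, hc, RingHom.id_apply]

theorem unitCharacter_unitsMap_of_anti {c : F →+* F} (hc : c.comp c = RingHom.id F)
    {k : (F →+* ℂ) → ℤ} (hk : ∀ σ, k (σ.comp c) = -k σ) (u : (𝓞 F)ˣ) :
    unitCharacter k 0 (unitsMap c u) = (unitCharacter k 0 u)⁻¹ := by
  rw [unitCharacter_unitsMap hc, eq_inv_iff_mul_eq_one, ← unitCharacter_add,
    ← unitCharacter_zero (F := F) u]
  congr 1
  · ext σ
    simp [hk]
  · ext σ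
    simp

theorem unitCharacter_one (k : (F →+* ℂ) → ℤ) (φ : (F →+* ℂ) → ℝ) :
    unitCharacter k φ 1 = 1 := by
  simp [unitCharacter]

theorem unitCharacter_zpow (k : (F →+* ℂ) → ℤ) (φ : (F →+* ℂ) → ℝ) (u : (𝓞 F)ˣ) (n : ℤ) :
    unitCharacter k φ (u ^ n) = unitCharacter k φ u ^ n := by
  simp only [unitCharacter, map_zpow, Finset.prod_zpow]

theorem unitCharacter_prod {ι : Type*} (s : Finset ι) (k : (F →+* ℂ) → ℤ) (φ : (F →+* ℂ) → ℝ)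
    (u : ι → (𝓞 F)ˣ) :
    unitCharacter k φ (∏ i ∈ s, u i) = ∏ i ∈ s, unitCharacter k φ (u i) := by
  classical
  induction s using Finset.induction_on with
  | empty => simp [unitCharacter_one]
  | insert a s ha ih => rw [Finset.prod_insert ha, Finset.prod_insert ha, unitCharacter_mul, ih]

/-- The parameters of the unramified Hecke characters that are anti-invariant under the
involution `c`: pairs `(k, φ)` with `k` odd and `φ` even under complex conjugation, both odd under
`c`, such that the associated archimedean character is trivial on the global units. -/
def antiParameters (c : F →+* F) : Submodule ℤ (((F →+* ℂ) → ℤ) × ((F →+* ℂ) → ℝ)) where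
  carrier := {p | (∀ σ, p.1 (ComplexEmbedding.conjugate σ) = -p.1 σ) ∧
    (∀ σ, p.1 (σ.comp c) = -p.1 σ) ∧ (∀ σ, p.2 (ComplexEmbedding.conjugate σ) = p.2 σ) ∧
    (∀ σ, p.2 (σ.comp c) = -p.2 σ) ∧ ∀ u : (𝓞 F)ˣ, unitCharacter p.1 p.2 u = 1}
  add_mem' := by
    rintro p q ⟨h1, h2, h3, h4, h5⟩ ⟨h1', h2', h3', h4', h5'⟩
    refine ⟨fun σ => ?_, fun σ => ?_, fun σ => ?_, fun σ => ?_, fun u => ?_⟩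
    · simp only [Prod.fst_add, Pi.add_apply, h1, h1']; ring
    · simp only [Prod.fst_add, Pi.add_apply, h2, h2']; ring
    · simp only [Prod.snd_add, Pi.add_apply, h3, h3']
    · simp only [Prod.snd_add, Pi.add_apply, h4, h4']; ring
    · rw [Prod.fst_add, Prod.snd_add, unitCharacter_add, h5, h5', one_mul]
  zero_mem' := by
    refine ⟨fun σ => ?_, fun σ => ?_, fun σ => ?_, fun σ => ?_, unitCharacter_zero⟩ <;> simp
  smul_mem' := by
    rintro n p ⟨h1, h2, h3, h4, h5⟩
    refine ⟨fun σ => ?_, fun σ => ?_, fun σ => ?_, fun σ => ?_, fun u => ?_⟩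
    · simp only [Prod.smul_fst, Pi.smul_apply, h1, smul_neg]
    · simp only [Prod.smul_fst, Pi.smul_apply, h2, smul_neg]
    · simp only [Prod.smul_snd, Pi.smul_apply, h3]
    · simp only [Prod.smul_snd, Pi.smul_apply, h4, smul_neg]
    · rw [Prod.smul_fst, Prod.smul_snd, unitCharacter_zsmul, h5, one_zpow]

theorem conjugate_comp_comm (c : F →+* F) (σ : F →+* ℂ) :
    (ComplexEmbedding.conjugate σ).comp c = ComplexEmbedding.conjugate (σ.comp c) := rfl

/-- The coordinate of a unit with respect to the fundamental system of units. -/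
noncomputable def unitCoord (i : Fin (Units.rank F)) : Additive (𝓞 F)ˣ →+ ℤ :=
  ((Units.basisUnitLattice F).coord i).toAddMonoidHom.comp
    ((Units.logEmbedding F).codRestrict (Units.unitLattice F)
      fun _ => Submodule.mem_map_of_mem trivial)

theorem unitCoord_eq (i : Fin (Units.rank F)) (u : (𝓞 F)ˣ) (e : Fin (Units.rank F) → ℤ)
    (h : Units.logEmbedding F (Additive.ofMul u) =
      ∑ i, e i • Units.logEmbedding F (Additive.ofMul (Units.fundSystem F i))) :
    unitCoord i (Additive.ofMul u) = e i := by
  have h1 : (Units.logEmbedding F).codRestrict (Units.unitLattice F)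
      (fun _ => Submodule.mem_map_of_mem trivial) (Additive.ofMul u) =
      ∑ i, e i • Units.basisUnitLattice F i := by
    refine Subtype.ext ?_
    simp only [Submodule.coe_sum, Submodule.coe_smul, ← Units.logEmbedding_fundSystem]
    exact h
  change (Units.basisUnitLattice F).repr _ i = e i
  rw [h1, (Units.basisUnitLattice F).repr_sum_self]

theorem exists_eq_torsion_mul_prod (u : (𝓞 F)ˣ) : ∃ ζ ∈ Units.torsion F,
    u = ζ * ∏ i, Units.fundSystem F i ^ unitCoord i (Additive.ofMul u) := by
  obtain ⟨⟨ζ, e⟩, he, -⟩ := Units.exist_unique_eq_mul_prod F u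
  refine ⟨ζ, ζ.2, ?_⟩
  have h1 : Additive.ofMul u = Additive.ofMul (ζ : (𝓞 F)ˣ) +
      ∑ i, e i • Additive.ofMul (Units.fundSystem F i) := by
    rw [he, ofMul_mul, ofMul_prod]
    simp only [ofMul_zpow]
  have h2 : ∀ i, unitCoord i (Additive.ofMul u) = e i := fun i => by
    refine unitCoord_eq i u e ?_
    rw [h1, map_add, Units.dirichletUnitTheorem.logEmbedding_eq_zero_iff.mpr ζ.2, zero_add, map_sum]
    simp only [map_zsmul]
  simp only [h2]
  exact he

theorem addMonoidHom_eq_sum (h : Additive (𝓞 F)ˣ →+ ℝ) (u : (𝓞 F)ˣ) :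
    h (Additive.ofMul u) = ∑ i, (unitCoord i (Additive.ofMul u) : ℝ) *
      h (Additive.ofMul (Units.fundSystem F i)) := by
  obtain ⟨ζ, hζ, hu⟩ := exists_eq_torsion_mul_prod u
  conv_lhs => rw [hu, ofMul_mul, map_add, addMonoidHom_eq_zero_of_mem_torsion h hζ, zero_add,
    ofMul_prod, map_sum]
  refine Finset.sum_congr rfl fun i _ => ?_
  rw [ofMul_zpow, map_zsmul, zsmul_eq_mul]

theorem exists_exp_eq_unitCharacter (k : (F →+* ℂ) → ℤ) :
    ∃ N : ℕ, 0 < N ∧ ∃ h : Additive (𝓞 F)ˣ →+ ℝ, ∀ u : (𝓞 F)ˣ,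
      Circle.exp (h (Additive.ofMul u)) = unitCharacter k 0 u ^ (N : ℤ) := by
  choose t ht using fun i : Fin (Units.rank F) =>
    Circle.exp_surjective (unitCharacter k 0 (Units.fundSystem F i) ^ (Units.torsionOrder F : ℤ))
  let h : Additive (𝓞 F)ˣ →+ ℝ :=
    ∑ i, (AddMonoidHom.mulRight (t i)).comp ((Int.castAddHom ℝ).comp (unitCoord i))
  have hh : ∀ u, h u = ∑ i, (unitCoord i u : ℝ) * t i := fun u => by
    simp [h]
  refine ⟨Units.torsionOrder F, Units.torsionOrder_pos F, h, fun u => ?_⟩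
  obtain ⟨ζ, hζ, hu⟩ := exists_eq_torsion_mul_prod u
  have hexp : ∀ s : Finset (Fin (Units.rank F)),
      Circle.exp (∑ i ∈ s, (unitCoord i (Additive.ofMul u) : ℝ) * t i) =
        ∏ i ∈ s, Circle.exp ((unitCoord i (Additive.ofMul u) : ℝ) * t i) := by
    classical
    intro s
    induction s using Finset.induction_on with
    | empty => simp
    | insert a s ha ih => rw [Finset.sum_insert ha, Finset.prod_insert ha, Circle.exp_add, ih]
  have hζ' : unitCharacter k 0 ζ ^ (Units.torsionOrder F : ℤ) = 1 := by
    have h1 : ζ ^ Units.torsionOrder F = 1 := by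
      rw [← mem_rootsOfUnity, Units.rootsOfUnity_eq_torsion]
      exact hζ
    rw [← unitCharacter_zpow, zpow_natCast, h1, unitCharacter_one]
  conv_rhs => rw [hu, unitCharacter_mul, mul_zpow, hζ', one_mul, unitCharacter_prod,
    ← Finset.prod_zpow]
  rw [hh, hexp]
  refine Finset.prod_congr rfl fun i _ => ?_
  rw [Circle.exp_intCast_mul, ht, unitCharacter_zpow, ← zpow_mul, ← zpow_mul, mul_comm]

theorem exists_mem_antiParameters {c : F →+* F} (hc : c.comp c = RingHom.id F)
    {k : (F →+* ℂ) → ℤ} (hk : ∀ σ, k (ComplexEmbedding.conjugate σ) = -k σ)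
    (hk' : ∀ σ, k (σ.comp c) = -k σ) :
    ∃ N : ℤ, 0 < N ∧ ∃ φ : (F →+* ℂ) → ℝ, (N • k, φ) ∈ antiParameters c := by
  obtain ⟨N, hN, h, hh⟩ := exists_exp_eq_unitCharacter k
  obtain ⟨φ, hφ, hφh⟩ := exists_logPairing_eq (-h)
  refine ⟨2 * N, by positivity, fun σ => φ σ - φ (σ.comp c), fun σ => ?_, fun σ => ?_,
    fun σ => ?_, fun σ => ?_, fun u => ?_⟩
  · simp only [Pi.smul_apply, hk, smul_neg]
  · simp only [Pi.smul_apply, hk', smul_neg]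
  · simp only [conjugate_comp_comm, hφ]
  · simp only [RingHom.comp_assoc, hc, RingHom.comp_id]
    ring
  · have h1 : logPairing F (fun σ => φ σ - φ (σ.comp c)) (Additive.ofMul u) =
        -h (Additive.ofMul u) + h (Additive.ofMul (unitsMap c u)) := by
      have : (fun σ : F →+* ℂ => φ σ - φ (σ.comp c)) = φ - fun σ => φ (σ.comp c) := rfl
      rw [this, map_sub, AddMonoidHom.sub_apply, ← logPairing_unitsMap hc, hφh]
      simp
    have h2 : unitCharacter ((2 * (N : ℤ)) • k) 0 u = unitCharacter k 0 u ^ (2 * (N : ℤ)) := by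
      rw [← unitCharacter_zsmul, smul_zero]
    rw [unitCharacter_eq_mul_exp, h1, h2, Circle.exp_add, Circle.exp_neg, hh, hh,
      unitCharacter_unitsMap_of_anti hc hk', two_mul, zpow_add, inv_zpow]
    group

theorem mem_span_antiParameters {c : F →+* F} (hc : c.comp c = RingHom.id F)
    {φ : (F →+* ℂ) → ℝ} (hφ : ∀ σ, φ (ComplexEmbedding.conjugate σ) = φ σ)
    (hφ' : ∀ σ, φ (σ.comp c) = -φ σ) :
    φ ∈ Submodule.span ℝ {ψ : (F →+* ℂ) → ℝ | ((0 : (F →+* ℂ) → ℤ), ψ) ∈ antiParameters c} := by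
  have hex : ∀ i : Fin (Units.rank F), ∃ ψ : (F →+* ℂ) → ℝ,
      (∀ σ, ψ (ComplexEmbedding.conjugate σ) = ψ σ) ∧ ∀ u : (𝓞 F)ˣ,
        logPairing F ψ (Additive.ofMul u) =
          unitCoord i (Additive.ofMul u) * (2 * Real.pi) := by
    intro i
    obtain ⟨ψ, hψ, h⟩ := exists_logPairing_eq
      ((AddMonoidHom.mulRight (2 * Real.pi)).comp ((Int.castAddHom ℝ).comp (unitCoord (F := F) i)))
    exact ⟨ψ, hψ, fun u => by rw [h]; rfl⟩
  choose ψ hψ hψu using hex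
  have hmem : ∀ i, (fun σ => ψ i σ - ψ i (σ.comp c)) ∈
      {ψ : (F →+* ℂ) → ℝ | ((0 : (F →+* ℂ) → ℤ), ψ) ∈ antiParameters c} := by
    intro i
    refine ⟨fun σ => by simp, fun σ => by simp, fun σ => ?_, fun σ => ?_, fun u => ?_⟩
    · simp only [conjugate_comp_comm, hψ]
    · simp only [RingHom.comp_assoc, hc, RingHom.comp_id]
      ring
    · have : (fun σ : F →+* ℂ => ψ i σ - ψ i (σ.comp c)) = ψ i - fun σ => ψ i (σ.comp c) := rfl
      rw [unitCharacter_zero_left, this, map_sub, AddMonoidHom.sub_apply,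
        ← logPairing_unitsMap hc, hψu, hψu, Circle.exp_sub, Circle.exp_int_mul_two_pi,
        Circle.exp_int_mul_two_pi, div_one]
  let a : Fin (Units.rank F) → ℝ := fun i =>
    logPairing F φ (Additive.ofMul (Units.fundSystem F i)) / (2 * Real.pi)
  let θ : (F →+* ℂ) → ℝ := φ - ∑ i, a i • ψ i
  have hθ : logPairing F θ = 0 := by
    refine AddMonoidHom.ext fun u => ?_
    change logPairing F θ (Additive.ofMul u.toMul) = 0
    rw [map_sub, map_sum, AddMonoidHom.sub_apply, AddMonoidHom.finsetSum_apply,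
      addMonoidHom_eq_sum, sub_eq_zero]
    refine Finset.sum_congr rfl fun i _ => ?_
    rw [map_smul, AddMonoidHom.smul_apply, hψu, smul_eq_mul]
    simp only [a]
    field_simp
  obtain ⟨C, hC⟩ := exists_add_conjugate_eq_of_logPairing_eq_zero hθ
  have hθc : ∀ σ, θ (ComplexEmbedding.conjugate σ) = θ σ := by
    intro σ
    simp only [θ, Pi.sub_apply, Finset.sum_apply, Pi.smul_apply, hφ, hψ]
  have hθC : ∀ σ, θ σ = C / 2 := by
    intro σ
    have := hC σ
    rw [hθc] at this
    linarith
  have key : φ = (1 / 2 : ℝ) • ∑ i, a i • fun σ => ψ i σ - ψ i (σ.comp c) := by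
    ext σ
    have h1 := hθC σ
    have h2 := hθC (σ.comp c)
    simp only [θ, Pi.sub_apply, Finset.sum_apply, Pi.smul_apply, smul_eq_mul, hφ'] at h1 h2
    simp only [Pi.smul_apply, Finset.sum_apply, smul_eq_mul, mul_sub, Finset.sum_sub_distrib]
    linarith
  rw [key]
  exact Submodule.smul_mem _ _ (Submodule.sum_mem _ fun i _ =>
    Submodule.smul_mem _ _ (Submodule.subset_span (hmem i)))

/-- The real function attached to a pair of parameters. -/
noncomputable def parameterSum (c : F →+* F) : antiParameters c →ₗ[ℤ] ((F →+* ℂ) → ℝ) where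
  toFun p := fun σ => (p.1.1 σ : ℝ) + p.1.2 σ
  map_add' p q := by
    ext σ
    simp
    ring
  map_smul' n p := by
    ext σ
    simp

theorem mem_span_parameterSum_of_conj_invariant {c : F →+* F} (hc : c.comp c = RingHom.id F)
    {φ : (F →+* ℂ) → ℝ} (hφ : ∀ σ, φ (ComplexEmbedding.conjugate σ) = φ σ)
    (hφ' : ∀ σ, φ (σ.comp c) = -φ σ) :
    φ ∈ Submodule.span ℝ (Set.range (parameterSum c)) := by
  refine Submodule.span_mono ?_ (mem_span_antiParameters hc hφ hφ')
  intro ψ hψ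
  exact ⟨⟨(0, ψ), hψ⟩, by ext σ; simp [parameterSum]⟩

theorem mem_span_parameterSum_of_conj_anti {c : F →+* F} (hc : c.comp c = RingHom.id F)
    {k : (F →+* ℂ) → ℤ} (hk : ∀ σ, k (ComplexEmbedding.conjugate σ) = -k σ)
    (hk' : ∀ σ, k (σ.comp c) = -k σ) :
    (fun σ => (k σ : ℝ)) ∈ Submodule.span ℝ (Set.range (parameterSum c)) := by
  obtain ⟨N, hN, φ, h⟩ := exists_mem_antiParameters hc hk hk'
  have h1 : parameterSum c ⟨_, h⟩ ∈ Submodule.span ℝ (Set.range (parameterSum c)) :=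
    Submodule.subset_span ⟨_, rfl⟩
  have h2 : φ ∈ Submodule.span ℝ (Set.range (parameterSum c)) :=
    mem_span_parameterSum_of_conj_invariant hc h.2.2.1 h.2.2.2.1
  have h3 : (fun σ => (k σ : ℝ)) = (N : ℝ)⁻¹ • (parameterSum c ⟨_, h⟩ - φ) := by
    have hN' : (N : ℝ) ≠ 0 := by exact_mod_cast hN.ne'
    ext σ
    simp [parameterSum, hN']
  rw [h3]
  exact Submodule.smul_mem _ _ (Submodule.sub_mem _ h1 h2)

theorem natCast_card_le_rank_antiParameters {c : F →+* F} (hc : c.comp c = RingHom.id F)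
    {ι : Type*} [Fintype ι] (s : ι → (F →+* ℂ)) (hs : Function.Injective s)
    (hs' : ∀ i j, (s i).comp c ≠ s j) :
    (Fintype.card ι : Cardinal) ≤ Module.rank ℤ (antiParameters c) := by
  classical
  let e : (F →+* ℂ) → (F →+* ℂ) → ℤ := fun τ => Pi.single τ 1 - Pi.single (τ.comp c) 1
  have hcc : ∀ σ : F →+* ℂ, (σ.comp c).comp c = σ := fun σ => by
    rw [RingHom.comp_assoc, hc, RingHom.comp_id]
  have he : ∀ τ σ, e τ (σ.comp c) = -e τ σ := by
    intro τ σ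
    have h1 : σ.comp c = τ ↔ σ = τ.comp c := by
      constructor
      · rintro rfl; rw [hcc]
      · rintro rfl; rw [hcc]
    have h2 : σ.comp c = τ.comp c ↔ σ = τ := by
      constructor
      · intro h; rw [← hcc σ, h, hcc]
      · rintro rfl; rfl
    simp only [e, Pi.sub_apply, Pi.single_apply, h1, h2]
    ring
  have hj : ∀ σ τ : F →+* ℂ, ComplexEmbedding.conjugate σ = τ ↔
      σ = ComplexEmbedding.conjugate τ := fun σ τ => by
    constructor
    · rintro rfl; exact (ComplexEmbedding.involutive_conjugate F σ).symm
    · rintro rfl; exact ComplexEmbedding.involutive_conjugate F τ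
  have hconj : ∀ τ σ, e τ (ComplexEmbedding.conjugate σ) = e (ComplexEmbedding.conjugate τ) σ := by
    intro τ σ
    simp only [e, Pi.sub_apply, Pi.single_apply, hj, conjugate_comp_comm]
  have hconj' : ∀ τ σ, e (ComplexEmbedding.conjugate τ) (ComplexEmbedding.conjugate σ) = e τ σ := by
    intro τ σ
    rw [hconj, ComplexEmbedding.involutive_conjugate F τ]
  refine natCast_card_le_rank_int_of_mem_span (parameterSum c)
    (v := fun i σ => (e (s i) σ : ℝ)) ?_ fun i => ?_
  · rw [Fintype.linearIndependent_iff]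
    intro g hg i
    have h1 := congrFun hg (s i)
    rw [Finset.sum_apply, Finset.sum_eq_single i] at h1
    · simpa [e, Pi.single_apply, (hs' i i).symm] using h1
    · intro j _ hji
      simp [e, Pi.single_apply, (hs' j i).symm, hs.eq_iff, hji.symm]
    · simp
  · have h1 := mem_span_parameterSum_of_conj_invariant hc
      (φ := fun σ => (e (s i) σ : ℝ) + (e (ComplexEmbedding.conjugate (s i)) σ : ℝ))
      (fun σ => by simp only [hconj', hconj]; ring)
      (fun σ => by simp only [he]; push_cast; ring)
    have h2 := mem_span_parameterSum_of_conj_anti hc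
      (k := fun σ => e (s i) σ - e (ComplexEmbedding.conjugate (s i)) σ)
      (fun σ => by simp only [hconj', hconj]; ring)
      (fun σ => by simp only [he]; ring)
    have h3 : (fun σ => (e (s i) σ : ℝ)) = (1 / 2 : ℝ) •
        ((fun σ => (e (s i) σ : ℝ) + (e (ComplexEmbedding.conjugate (s i)) σ : ℝ)) +
          fun σ => ((e (s i) σ - e (ComplexEmbedding.conjugate (s i)) σ : ℤ) : ℝ)) := by
      ext σ
      simp only [Pi.smul_apply, Pi.add_apply, smul_eq_mul]
      push_cast
      ring
    rw [h3]
    exact Submodule.smul_mem _ _ (Submodule.add_mem _ h1 h2)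

end Hecke

section Galois

variable {k F L : Type*} [Field k] [Field F] [Field L] [Algebra k F] [Algebra k L]
  [FiniteDimensional k L] [IsGalois k L]

theorem exists_algEquiv_comp_eq (s t : F →ₐ[k] L) : ∃ g : Gal(L/k), (g : L →ₐ[k] L).comp s = t := by
  let e : s.fieldRange ≃ₐ[k] t.fieldRange :=
    (AlgEquiv.ofInjectiveField s).symm.trans (AlgEquiv.ofInjectiveField t)
  refine ⟨e.liftNormal L, ?_⟩
  ext x
  have h := e.liftNormal_commutes L (AlgEquiv.ofInjectiveField s x)
  have h1 : e (AlgEquiv.ofInjectiveField s x) = AlgEquiv.ofInjectiveField t x :=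
    congrArg (AlgEquiv.ofInjectiveField t) ((AlgEquiv.ofInjectiveField s).symm_apply_apply x)
  rw [h1] at h
  exact h

/-- Two embeddings into a Galois extension that agree on the preimage of the fixed field of a
normal subgroup differ by an element of this subgroup. -/
theorem exists_mem_comp_eq_of_eqOn (N : Subgroup Gal(L/k)) [N.Normal] {s t : F →ₐ[k] L}
    (h : ∀ x, s x ∈ IntermediateField.fixedField N → t x = s x) :
    ∃ n ∈ N, (n : L →ₐ[k] L).comp s = t := by
  obtain ⟨g, hg⟩ := exists_algEquiv_comp_eq s t
  have h1 : g ∈ (s.fieldRange ⊓ IntermediateField.fixedField N).fixingSubgroup := by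
    rw [IntermediateField.mem_fixingSubgroup_iff]
    rintro _ ⟨⟨x, rfl⟩, hx⟩
    exact (DFunLike.congr_fun hg x).trans (h x hx)
  have h2 : (s.fieldRange ⊓ IntermediateField.fixedField N).fixingSubgroup =
      s.fieldRange.fixingSubgroup ⊔ N := by
    have h3 : (s.fieldRange ⊓ IntermediateField.fixedField N).fixingSubgroup =
        s.fieldRange.fixingSubgroup ⊔ (IntermediateField.fixedField N).fixingSubgroup :=
      (IsGalois.intermediateFieldEquivSubgroup (F := k) (E := L)).map_inf s.fieldRange
        (IntermediateField.fixedField N)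
    rwa [IntermediateField.fixingSubgroup_fixedField] at h3
  rw [h2, Subgroup.mem_sup_of_normal_right] at h1
  obtain ⟨a, ha, n, hn, rfl⟩ := h1
  rw [IntermediateField.mem_fixingSubgroup_iff] at ha
  refine ⟨a * n * a⁻¹, Subgroup.Normal.conj_mem inferInstance n hn a, ?_⟩
  rw [← hg]
  ext x
  have h4 : a⁻¹ (s x) = s x := by
    rw [AlgEquiv.aut_inv, AlgEquiv.symm_apply_eq]
    exact (ha _ ⟨x, rfl⟩).symm
  change (a * n * a⁻¹) (s x) = (a * n) (s x)
  rw [AlgEquiv.mul_apply, h4]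

/-- The action of the Galois group on embeddings by composition. -/
def galComp (g : Gal(L/k)) (s : F →ₐ[k] L) : F →ₐ[k] L := (g : L →ₐ[k] L).comp s

theorem galComp_apply (g : Gal(L/k)) (s : F →ₐ[k] L) (x : F) : galComp g s x = g (s x) := rfl

theorem galComp_mul (g h : Gal(L/k)) (s : F →ₐ[k] L) :
    galComp (g * h) s = galComp g (galComp h s) := rfl

theorem galComp_one (s : F →ₐ[k] L) : galComp (1 : Gal(L/k)) s = s := rfl

theorem galComp_inv_galComp (g : Gal(L/k)) (s : F →ₐ[k] L) : galComp g⁻¹ (galComp g s) = s := by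
  rw [← galComp_mul, inv_mul_cancel, galComp_one]

theorem galComp_galComp_inv (g : Gal(L/k)) (s : F →ₐ[k] L) : galComp g (galComp g⁻¹ s) = s := by
  rw [← galComp_mul, mul_inv_cancel, galComp_one]

variable {ρ : Gal(L/k)} {κ : (F →ₐ[k] L) → ℤ}

theorem eq_or_eq_neg_of_mem_normalClosure (hκ : ∀ g s, κ (galComp (g * ρ * g⁻¹) s) = -κ s)
    {n : Gal(L/k)} (hn : n ∈ Subgroup.normalClosure {ρ}) :
    (∀ s, κ (galComp n s) = κ s) ∨ ∀ s, κ (galComp n s) = -κ s := by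
  induction hn using Subgroup.closure_induction with
  | mem x hx =>
    obtain ⟨a, ha, hax⟩ := Group.mem_conjugatesOfSet_iff.mp hx
    obtain ⟨c, rfl⟩ := isConj_iff.mp hax
    rw [Set.mem_singleton_iff.mp ha]
    exact Or.inr (hκ c)
  | one => exact Or.inl fun s => rfl
  | mul x y _ _ hx hy =>
    rcases hx with hx | hx <;> rcases hy with hy | hy <;> simp [galComp_mul, hx, hy]
  | inv x _ hx =>
    rcases hx with hx | hx
    · exact Or.inl fun s => by rw [← hx, galComp_galComp_inv]
    · exact Or.inr fun s => by rw [← galComp_galComp_inv x s, hx, galComp_galComp_inv, neg_neg]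

variable (ρ) in
/-- The normal subgroup generated by the commutators with `ρ`. -/
def commutatorClosure : Subgroup Gal(L/k) :=
  Subgroup.normalClosure (Set.range fun g : Gal(L/k) => g * ρ * g⁻¹ * ρ⁻¹)

instance commutatorClosure_normal : (commutatorClosure ρ).Normal := Subgroup.normalClosure_normal

theorem eq_of_mem_commutatorClosure (hκ : ∀ g s, κ (galComp (g * ρ * g⁻¹) s) = -κ s)
    {n : Gal(L/k)} (hn : n ∈ commutatorClosure ρ) (s : F →ₐ[k] L) : κ (galComp n s) = κ s := by
  revert s
  induction hn using Subgroup.closure_induction with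
  | mem x hx =>
    intro s
    obtain ⟨a, ⟨g, rfl⟩, hax⟩ := Group.mem_conjugatesOfSet_iff.mp hx
    obtain ⟨c, rfl⟩ := isConj_iff.mp hax
    have h1 : c * (g * ρ * g⁻¹ * ρ⁻¹) * c⁻¹ =
        ((c * g) * ρ * (c * g)⁻¹) * (c * ρ * c⁻¹)⁻¹ := by group
    rw [h1, galComp_mul, hκ, ← hκ c, galComp_galComp_inv]
  | one => exact fun s => rfl
  | mul x y _ _ hx hy => exact fun s => by rw [galComp_mul, hx, hy]
  | inv x _ hx => exact fun s => by rw [← hx, galComp_galComp_inv]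

theorem mem_fixedField_iff_of_normal (N : Subgroup Gal(L/k)) [N.Normal] (s t : F →ₐ[k] L) (x : F) :
    s x ∈ IntermediateField.fixedField N ↔ t x ∈ IntermediateField.fixedField N := by
  have key : ∀ s t : F →ₐ[k] L, s x ∈ IntermediateField.fixedField N →
      t x ∈ IntermediateField.fixedField N := by
    intro s t h
    obtain ⟨g, rfl⟩ := exists_algEquiv_comp_eq s t
    rw [IntermediateField.mem_fixedField_iff] at h ⊢
    intro n hn
    have h1 := h (g⁻¹ * n * g) (by
      simpa using Subgroup.Normal.conj_mem inferInstance n hn g⁻¹)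
    have h2 := congrArg g h1
    rwa [← AlgEquiv.mul_apply, ← mul_assoc, mul_inv_cancel_left] at h2
  exact ⟨key s t, key t s⟩

theorem apply_comm_of_mem_fixedField {z : L}
    (hz : z ∈ IntermediateField.fixedField (commutatorClosure ρ)) (g : Gal(L/k)) :
    g (ρ z) = ρ (g z) := by
  have h1 : ρ * g * ρ⁻¹ * g⁻¹ ∈ commutatorClosure ρ := by
    have : g * ρ * g⁻¹ * ρ⁻¹ ∈ commutatorClosure ρ :=
      Subgroup.subset_normalClosure ⟨g, rfl⟩
    have h2 := inv_mem this
    convert h2 using 1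
    group
  have h2 : g⁻¹ * ρ⁻¹ * (ρ * g * ρ⁻¹ * g⁻¹)⁻¹ * ρ * g ∈ commutatorClosure ρ := by
    have := Subgroup.Normal.conj_mem inferInstance _ (inv_mem h1) (g⁻¹ * ρ⁻¹)
    convert this using 1
    group
  have h3 := (IntermediateField.mem_fixedField_iff _ _).mp hz _ h2
  have h4 := congrArg (ρ * g : Gal(L/k)) h3
  rw [← AlgEquiv.mul_apply] at h4
  have h5 : ρ * g * (g⁻¹ * ρ⁻¹ * (ρ * g * ρ⁻¹ * g⁻¹)⁻¹ * ρ * g) = g * ρ := by group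
  rw [h5] at h4
  exact h4

/-- On the preimage of the fixed field of the commutators with `ρ`, the automorphism `ρ` induces a
map of `F` that is independent of the embedding. -/
theorem exists_apply_eq_of_mem_fixedField (s : F →ₐ[k] L) {x : F}
    (hx : s x ∈ IntermediateField.fixedField (commutatorClosure ρ)) :
    ∃ y : F, s y ∈ IntermediateField.fixedField (commutatorClosure ρ) ∧
      ∀ t : F →ₐ[k] L, t y = ρ (t x) := by
  have h1 : ρ (s x) ∈ s.fieldRange := by
    rw [← IsGalois.fixedField_fixingSubgroup s.fieldRange, IntermediateField.mem_fixedField_iff]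
    intro h hh
    rw [apply_comm_of_mem_fixedField hx]
    exact congrArg ρ ((IntermediateField.mem_fixingSubgroup_iff _ _).mp hh _ ⟨x, rfl⟩)
  obtain ⟨y, hy⟩ := h1
  have hy' : s y = ρ (s x) := hy
  refine ⟨y, ?_, fun t => ?_⟩
  · rw [IntermediateField.mem_fixedField_iff]
    intro n hn
    rw [hy', apply_comm_of_mem_fixedField hx, (IntermediateField.mem_fixedField_iff _ _).mp hx n hn]
  · obtain ⟨g, rfl⟩ := exists_algEquiv_comp_eq s t
    change g (s y) = ρ (g (s x))
    rw [hy', apply_comm_of_mem_fixedField hx]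

end Galois

/-- A number field on which complex conjugation induces a nontrivial map that is independent of
the complex embedding is a CM field. -/
theorem NumberField.IsCMField.of_exists_conj {K : Type*} [Field K] [NumberField K]
    (h : ∀ x : K, ∃ y : K, ∀ τ : K →+* ℂ, τ y = (starRingEnd ℂ) (τ x))
    (h' : ∃ (x : K) (τ : K →+* ℂ), (starRingEnd ℂ) (τ x) ≠ τ x) : IsCMField K := by
  choose c hc using h
  obtain ⟨x₀, τ₀, hx₀⟩ := h'
  have hinj : ∀ {a b : K}, τ₀ a = τ₀ b → a = b := fun h => τ₀.injective h
  have hcc : Function.Involutive c := fun x => hinj (by rw [hc, hc, Complex.conj_conj])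
  let e : K ≃+* K :=
    { hcc.toPerm with
      map_mul' := fun x y => hinj (by
        change τ₀ (c (x * y)) = τ₀ (c x * c y)
        rw [hc, map_mul, map_mul, map_mul, hc, hc])
      map_add' := fun x y => hinj (by
        change τ₀ (c (x + y)) = τ₀ (c x + c y)
        rw [hc, map_add, map_add, map_add, hc, hc]) }
  have he : ∀ x, e x = c x := fun _ => rfl
  have he1 : e ≠ 1 := by
    intro h1
    apply hx₀
    rw [← hc, ← he, h1]
    rfl
  have he2 : e ^ 2 = 1 := by
    ext x
    rw [pow_two]
    exact hcc x
  have hord : orderOf e = 2 := orderOf_eq_prime he2 he1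
  have htc : IsTotallyComplex K := by
    refine ⟨fun w => ?_⟩
    rw [← InfinitePlace.not_isReal_iff_isComplex]
    intro hw
    apply he1
    ext x
    apply w.embedding.injective
    rw [he, hc]
    exact RingHom.congr_fun
      (ComplexEmbedding.isReal_iff.mp (InfinitePlace.isReal_iff.mp hw)) x
  let G := Subgroup.zpowers e
  have hGcard : Nat.card G = 2 := by rw [Nat.card_zpowers, hord]
  have : Finite G := Nat.finite_of_card_ne_zero (by rw [hGcard]; norm_num)
  have := Fintype.ofFinite G
  have hfix : ∀ x : K, x ∈ FixedPoints.subfield G K ↔ x ∈ maximalRealSubfield K := by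
    intro x
    rw [mem_maximalRealSubfield_iff]
    have h1 : x ∈ FixedPoints.subfield G K ↔ c x = x := by
      constructor
      · intro hx
        exact hx ⟨e, Subgroup.mem_zpowers e⟩
      · rintro hx ⟨g, hg⟩
        obtain ⟨n, rfl⟩ := Subgroup.mem_zpowers_iff.mp hg
        have hst : e ∈ MulAction.stabilizer (K ≃+* K) x := hx
        exact zpow_mem hst n
    rw [h1]
    constructor
    · intro hx τ
      exact (hc x τ).symm.trans (congrArg τ hx)
    · intro hx
      exact hinj ((hc x τ₀).trans (hx τ₀))
  have heq : FixedPoints.subfield G K = maximalRealSubfield K := SetLike.ext hfix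
  have hrank : Module.finrank (FixedPoints.subfield G K) K = 2 := by
    rw [FixedPoints.finrank_eq_card, ← Nat.card_eq_fintype_card, hGcard]
  rw [heq] at hrank
  exact { to_isTotallyComplex := htc, is_quadratic := ⟨hrank⟩ }

namespace Hecke
universe u
variable {F : Type u} [Field F] [NumberField F]

theorem prod_zpow_eq_one_of_unitCharacter {k : (F →+* ℂ) → ℤ}
    (hk : ∀ σ, k (ComplexEmbedding.conjugate σ) = -k σ) {u : (𝓞 F)ˣ}
    (hu : unitCharacter k 0 u = 1) : ∏ σ : F →+* ℂ, σ (u : F) ^ k σ = 1 := by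
  have hnorm : ∏ σ : F →+* ℂ, ‖σ (u : F)‖ ^ k σ = 1 := by
    have h1 : ∏ σ : F →+* ℂ, ‖σ (u : F)‖ ^ k σ = (∏ σ : F →+* ℂ, ‖σ (u : F)‖ ^ k σ)⁻¹ := by
      conv_lhs => rw [← Equiv.prod_comp (ComplexEmbedding.involutive_conjugate F).toPerm]
      rw [← Finset.prod_inv_distrib]
      refine Finset.prod_congr rfl fun σ _ => ?_
      change ‖ComplexEmbedding.conjugate σ (u : F)‖ ^ k (ComplexEmbedding.conjugate σ) = _
      rw [hk, zpow_neg, ComplexEmbedding.conjugate_coe_eq, RCLike.norm_conj]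
    have h0 : 0 < ∏ σ : F →+* ℂ, ‖σ (u : F)‖ ^ k σ :=
      Finset.prod_pos fun σ _ => zpow_pos (by simp) _
    have h2 := mul_inv_cancel₀ h0.ne'
    rw [← h1] at h2
    nlinarith
  have h1 := congrArg (Circle.coeHom : Circle →* ℂ) hu
  rw [unitCharacter, map_prod, map_one] at h1
  have h2 : ∀ σ : F →+* ℂ, (Circle.coeHom (archCharacter (k σ) ((0 : (F →+* ℂ) → ℝ) σ)
      (unitsEmbedding σ u)) : ℂ) = σ (u : F) ^ k σ / ((‖σ (u : F)‖ ^ k σ : ℝ) : ℂ) := by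
    intro σ
    change ((archCharacter (k σ) ((0 : (F →+* ℂ) → ℝ) σ) (unitsEmbedding σ u) : Circle) : ℂ) = _
    rw [archCharacter_apply, Pi.zero_apply, zero_mul, Circle.exp_zero, mul_one, Circle.coe_zpow,
      Circle.coe_ofUnits, div_zpow, coe_unitsEmbedding]
    push_cast
    rfl
  simp only [h2, Finset.prod_div_distrib, ← Complex.ofReal_prod, hnorm] at h1
  simpa using h1

section Weil

variable {L : Type*} [Field L] [Algebra ℚ L] [FiniteDimensional ℚ L] [IsGalois ℚ L]
  {ι : L →+* ℂ} {ρ : Gal(L/ℚ)} {k : (F →+* ℂ) → ℤ}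

/-- If `k` is the infinity type of a character that is trivial on the global units, then all
conjugates of complex conjugation act on `k` by `-1`. -/
theorem galComp_conj_eq_neg (hρ : ∀ z, ι (ρ z) = (starRingEnd ℂ) (ι z))
    (hι : ∀ σ : F →+* ℂ, ∃ s : F →ₐ[ℚ] L, ι.comp s.toRingHom = σ)
    (hk : ∀ σ, k (ComplexEmbedding.conjugate σ) = -k σ)
    (hu : ∀ u : (𝓞 F)ˣ, unitCharacter k 0 u = 1) (g : Gal(L/ℚ)) (s : F →ₐ[ℚ] L) :
    k (ι.comp (galComp (g * ρ * g⁻¹) s).toRingHom) = -k (ι.comp s.toRingHom) := by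
  let e : (F →ₐ[ℚ] L) ≃ (F →+* ℂ) := Equiv.ofBijective (fun s => ι.comp s.toRingHom) (by
    refine ⟨fun s t h => ?_, hι⟩
    ext x
    exact ι.injective (RingHom.congr_fun h x))
  have he : ∀ (s : F →ₐ[ℚ] L) x, e s x = ι (s x) := fun _ _ => rfl
  have heρ : ∀ s, e (galComp ρ s) = ComplexEmbedding.conjugate (e s) := by
    intro s
    ext x
    rw [he, galComp_apply, hρ]
    rfl
  let P : Gal(L/ℚ) → Equiv.Perm (F →ₐ[ℚ] L) := fun g =>
    ⟨galComp g, galComp g⁻¹, galComp_inv_galComp g, galComp_galComp_inv g⟩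
  let a : (F →+* ℂ) → ℝ := fun σ => k (e (galComp g (e.symm σ)))
  have ha : logPairing F a = 0 := by
    refine AddMonoidHom.ext fun u' => ?_
    obtain ⟨u, rfl⟩ := Additive.ofMul.surjective u'
    have h1 := prod_zpow_eq_one_of_unitCharacter hk (hu u)
    rw [← e.prod_comp] at h1
    have h2 : ∏ s : F →ₐ[ℚ] L, s (u : F) ^ k (e s) = 1 := by
      apply ι.injective
      rw [map_prod, map_one, ← h1]
      refine Finset.prod_congr rfl fun s _ => ?_
      rw [map_zpow₀, he]
    have h3 := congrArg (g⁻¹ : Gal(L/ℚ)) h2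
    rw [map_prod, map_one, ← Equiv.prod_comp (P g)] at h3
    have h4 : ∏ s : F →ₐ[ℚ] L, ‖e s (u : F)‖ ^ k (e (galComp g s)) = 1 := by
      have h5 := congrArg (fun z => ‖ι z‖) h3
      simp only [map_prod, map_one, norm_one, norm_prod] at h5
      rw [← h5]
      refine Finset.prod_congr rfl fun s _ => ?_
      change _ = ‖ι (g⁻¹ (g (s (u : F)) ^ k (e (galComp g s))))‖
      rw [map_zpow₀, map_zpow₀, norm_zpow, he, ← AlgEquiv.mul_apply, inv_mul_cancel]
      rfl
    have h6 := congrArg Real.log h4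
    rw [Real.log_one, Real.log_prod (fun s _ => zpow_ne_zero _ (by simp))] at h6
    rw [logPairing_apply, AddMonoidHom.zero_apply, ← e.sum_comp, ← h6]
    refine Finset.sum_congr rfl fun s _ => ?_
    rw [Real.log_zpow]
    simp [a]
  obtain ⟨C, hC⟩ := exists_add_conjugate_eq_of_logPairing_eq_zero ha
  have hC' : ∀ s : F →ₐ[ℚ] L, (k (e (galComp g s)) : ℝ) + k (e (galComp g (galComp ρ s))) = C := by
    intro s
    have := hC (e s)
    rw [← heρ] at this
    simpa [a] using this
  have hsum : ∑ s : F →ₐ[ℚ] L, (k (e s) : ℝ) = 0 := by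
    have h1 : ∑ s : F →ₐ[ℚ] L, (k (e s) : ℝ) = -∑ s : F →ₐ[ℚ] L, (k (e s) : ℝ) := by
      conv_lhs => rw [← Equiv.sum_comp (P ρ)]
      rw [← Finset.sum_neg_distrib]
      refine Finset.sum_congr rfl fun s _ => ?_
      change (k (e (galComp ρ s)) : ℝ) = _
      rw [heρ, hk]
      push_cast
      rfl
    linarith
  have hC0 : C = 0 := by
    have h1 : ∑ s : F →ₐ[ℚ] L, ((k (e (galComp g s)) : ℝ) + k (e (galComp g (galComp ρ s)))) =
        ∑ s : F →ₐ[ℚ] L, C := Finset.sum_congr rfl fun s _ => hC' s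
    have h2 : ∑ s : F →ₐ[ℚ] L, (k (e (galComp g s)) : ℝ) = 0 := by
      rw [← hsum]
      exact Equiv.sum_comp (P g) fun s => (k (e s) : ℝ)
    have h3 : ∑ s : F →ₐ[ℚ] L, (k (e (galComp g (galComp ρ s))) : ℝ) = 0 := by
      rw [← h2]
      exact Equiv.sum_comp (P ρ) fun s => (k (e (galComp g s)) : ℝ)
    rw [Finset.sum_add_distrib, h2, h3, Finset.sum_const, add_zero, nsmul_eq_mul] at h1
    have h4 : (Finset.univ : Finset (F →ₐ[ℚ] L)).card ≠ 0 := by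
      rw [Finset.card_ne_zero]
      exact ⟨s, Finset.mem_univ s⟩
    have h5 : ((Finset.univ : Finset (F →ₐ[ℚ] L)).card : ℝ) ≠ 0 := by exact_mod_cast h4
    exact (mul_eq_zero.mp h1.symm).resolve_left h5
  have h1 := hC' (galComp g⁻¹ s)
  rw [galComp_galComp_inv, hC0, ← galComp_mul, ← galComp_mul] at h1
  have h2 : k (e s) + k (e (galComp (g * (ρ * g⁻¹)) s)) = 0 := by exact_mod_cast h1
  rw [← mul_assoc] at h2
  change k (e (galComp (g * ρ * g⁻¹) s)) = -k (e s)
  omega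

end Weil

variable (F) in
theorem exists_galoisClosure : ∃ (L : IntermediateField ℚ ℂ) (_ : FiniteDimensional ℚ L)
    (_ : IsGalois ℚ L), (∀ σ : F →+* ℂ, ∃ s : F →ₐ[ℚ] L, (algebraMap L ℂ).comp s.toRingHom = σ) ∧
      ∃ ρ : Gal(L/ℚ), ∀ z, algebraMap L ℂ (ρ z) = (starRingEnd ℂ) (algebraMap L ℂ z) := by
  let L := IntermediateField.normalClosure ℚ F ℂ
  have hcl : IsNormalClosure ℚ F L :=
    Algebra.IsAlgebraic.isNormalClosure_normalClosure fun x => IsAlgClosed.splits _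
  have hn : Normal ℚ L := hcl.normal
  have hfd : FiniteDimensional ℚ L := normalClosure.is_finiteDimensional ℚ F ℂ
  refine ⟨L, hfd, { to_normal := hn }, fun σ => ?_,
    (Complex.conjAe.restrictScalars ℚ).restrictNormal L, fun z => ?_⟩
  · refine ⟨(normalClosure.algHomEquiv ℚ F ℂ).symm σ.toRatAlgHom, ?_⟩
    ext x
    have := (normalClosure.algHomEquiv ℚ F ℂ).apply_symm_apply σ.toRatAlgHom
    exact DFunLike.congr_fun this x
  · exact (Complex.conjAe.restrictScalars ℚ).restrictNormal_commutes L z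

variable {k : (F →+* ℂ) → ℤ}

/-- The infinity type of a character that is trivial on the global units is determined up to sign
by the restrictions of the embeddings to the maximal real subfield. -/
theorem eq_or_eq_neg_of_eqOn_maximalRealSubfield
    (hk : ∀ σ, k (ComplexEmbedding.conjugate σ) = -k σ)
    (hu : ∀ u : (𝓞 F)ˣ, unitCharacter k 0 u = 1) {σ τ : F →+* ℂ}
    (h : ∀ x ∈ maximalRealSubfield F, τ x = σ x) : k τ = k σ ∨ k τ = -k σ := by
  obtain ⟨L, _, _, hι, ρ, hρ⟩ := exists_galoisClosure F
  obtain ⟨s, rfl⟩ := hι σ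
  obtain ⟨t, rfl⟩ := hι τ
  have hconj := galComp_conj_eq_neg hρ hι hk hu
  obtain ⟨n, hn, rfl⟩ := exists_mem_comp_eq_of_eqOn (Subgroup.normalClosure {ρ}) (s := s) (t := t)
    (by
      intro x hx
      apply (algebraMap L ℂ).injective
      apply h x
      rw [mem_maximalRealSubfield_iff]
      intro θ
      obtain ⟨t', rfl⟩ := hι θ
      have h1 := (mem_fixedField_iff_of_normal _ s t' x).mp hx
      rw [IntermediateField.mem_fixedField_iff] at h1
      have h2 := h1 ρ (Subgroup.subset_normalClosure rfl)
      exact (hρ (t' x)).symm.trans (congrArg _ h2))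
  rcases eq_or_eq_neg_of_mem_normalClosure
    (κ := fun s : F →ₐ[ℚ] L => k ((algebraMap L ℂ).comp s.toRingHom)) hconj hn with h1 | h1
  · exact Or.inl (h1 s)
  · exact Or.inr (h1 s)

/-- If there is a nontrivial infinity type of characters that are trivial on the global units, then
the field contains a CM field. -/
theorem exists_isCMField_of_ne_zero
    (hk : ∀ σ, k (ComplexEmbedding.conjugate σ) = -k σ)
    (hu : ∀ u : (𝓞 F)ˣ, unitCharacter k 0 u = 1) (hk0 : k ≠ 0) :
    ∃ K : IntermediateField ℚ F, IsCMField K := by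
  obtain ⟨L, _, _, hι, ρ, hρ⟩ := exists_galoisClosure F
  have hconj := galComp_conj_eq_neg hρ hι hk hu
  obtain ⟨σ, hσ⟩ := Function.ne_iff.mp hk0
  obtain ⟨s, rfl⟩ := hι σ
  let K : IntermediateField ℚ F :=
    (IntermediateField.fixedField (commutatorClosure ρ)).comap s
  have hK : ∀ x, x ∈ K ↔ s x ∈ IntermediateField.fixedField (commutatorClosure ρ) :=
    fun x => Iff.rfl
  have hext : ∀ τ : K →+* ℂ, ∃ t : F →ₐ[ℚ] L, ∀ x : K, τ x = algebraMap L ℂ (t x) := by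
    intro τ
    obtain ⟨t, ht⟩ := hι (ComplexEmbedding.lift F τ)
    refine ⟨t, fun x => ?_⟩
    rw [← ComplexEmbedding.lift_algebraMap_apply F τ x, ← ht]
    rfl
  refine ⟨K, NumberField.IsCMField.of_exists_conj (fun x => ?_) ?_⟩
  · obtain ⟨y, hy, hy'⟩ := exists_apply_eq_of_mem_fixedField s ((hK x).mp x.2)
    refine ⟨⟨y, (hK y).mpr hy⟩, fun τ => ?_⟩
    obtain ⟨t, ht⟩ := hext τ
    rw [ht, ht, ← hρ, ← hy' t]
  · by_contra! hreal
    obtain ⟨n, hn, hns⟩ := exists_mem_comp_eq_of_eqOn (commutatorClosure ρ) (s := s)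
      (t := galComp ρ s) (by
        intro x hx
        apply (algebraMap L ℂ).injective
        rw [galComp_apply, hρ]
        exact hreal ⟨x, hx⟩ (((algebraMap L ℂ).comp s.toRingHom).comp (algebraMap K F)))
    have h1 := eq_of_mem_commutatorClosure
      (κ := fun s : F →ₐ[ℚ] L => k ((algebraMap L ℂ).comp s.toRingHom)) hconj hn s
    have h2 := hconj 1 s
    rw [one_mul, inv_one, mul_one, ← hns] at h2
    have h3 := h1.symm.trans h2
    apply hσ
    change k _ = 0
    omega

/-- The projection to the continuous parameters. -/
def continuousParameters (c : F →+* F) : antiParameters c →ₗ[ℤ] ((F →+* ℂ) → ℝ) :=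
  (LinearMap.snd ℤ _ _).comp (antiParameters c).subtype

theorem unitCharacter_of_mem_ker {c : F →+* F} {p : antiParameters c}
    (hp : p ∈ LinearMap.ker (continuousParameters c)) (u : (𝓞 F)ˣ) :
    unitCharacter p.1.1 0 u = 1 := by
  have h1 : p.1.2 = 0 := hp
  rw [← h1]
  exact p.2.2.2.2.2 u

theorem rank_ker_continuousParameters_le (c : F →+* F) :
    Module.rank ℤ (LinearMap.ker (continuousParameters c)) ≤ (cmRank F : Cardinal) := by
  classical
  by_cases hCM : ∃ K : IntermediateField ℚ F, IsCMField K
  · rw [cmRank, if_pos hCM]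
    let f : LinearMap.ker (continuousParameters c) →ₗ[ℤ] ((maximalRealSubfield F →+* ℂ) → ℤ) :=
      { toFun := fun p η => p.1.1.1 (ComplexEmbedding.lift F η)
        map_add' := fun _ _ => rfl
        map_smul' := fun _ _ => rfl }
    have hf : Function.Injective f := by
      rw [injective_iff_map_eq_zero]
      intro p hp
      have h0 : ∀ σ, p.1.1.1 σ = 0 := by
        intro σ
        let η : maximalRealSubfield F →+* ℂ := σ.comp (algebraMap (maximalRealSubfield F) F)
        have h1 : p.1.1.1 (ComplexEmbedding.lift F η) = 0 := congrFun hp η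
        rcases eq_or_eq_neg_of_eqOn_maximalRealSubfield p.1.2.1 (unitCharacter_of_mem_ker p.2)
          (σ := ComplexEmbedding.lift F η) (τ := σ)
          (fun x hx => (ComplexEmbedding.lift_algebraMap_apply F η ⟨x, hx⟩).symm) with h | h
        · rw [h, h1]
        · rw [h, h1, neg_zero]
      refine Subtype.ext (Subtype.ext (Prod.ext (funext h0) ?_))
      exact p.2
    have h1 := LinearMap.lift_rank_le_of_injective f hf
    rw [rank_fun', Embeddings.card] at h1
    simpa using h1
  · have hsub : Subsingleton (LinearMap.ker (continuousParameters c)) := by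
      refine subsingleton_of_forall_eq 0 fun p => ?_
      refine Subtype.ext (Subtype.ext (Prod.ext ?_ p.2))
      by_contra hne
      exact hCM (exists_isCMField_of_ne_zero p.1.2.1 (unitCharacter_of_mem_ker p.2) hne)
    rw [rank_subsingleton']
    simp

end Hecke

namespace Hecke
universe u v
variable {F₀ : Type u} {F : Type v} [Field F₀] [NumberField F₀] [Field F] [NumberField F]
  [Algebra F₀ F]

theorem two_mul_finrank_eq (hquad : Module.finrank F₀ F = 2) :
    Module.finrank ℚ F₀ * 2 =
      Module.finrank ℚ (maximalRealSubfield F) * Module.finrank (maximalRealSubfield F) F := by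
  rw [← hquad, Module.finrank_mul_finrank ℚ F₀ F, Module.finrank_mul_finrank]

theorem two_le_finrank_maximalRealSubfield (h : ∃ K : IntermediateField ℚ F, IsCMField K) :
    IsTotallyComplex F ∧ 2 ≤ Module.finrank (maximalRealSubfield F) F := by
  obtain ⟨K, hK⟩ := h
  have htc : IsTotallyComplex F := isTotallyComplex_of_algebra K F
  refine ⟨htc, ?_⟩
  have hpos : 0 < Module.finrank (maximalRealSubfield F) F := Module.finrank_pos
  have hne : Module.finrank (maximalRealSubfield F) F ≠ 1 := by
    intro h1
    have htop : maximalRealSubfield F = ⊤ := by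
      rw [eq_top_iff]
      intro x _
      obtain ⟨c, hc⟩ := (finrank_eq_one_iff_of_nonzero' (1 : F) one_ne_zero).mp h1 x
      rw [← hc, Algebra.smul_def, mul_one]
      exact c.2
    have := maximalRealSubfield_eq_top_iff_isTotallyReal.mp htop
    obtain w : InfinitePlace F := Classical.choice inferInstance
    exact InfinitePlace.not_isReal_iff_isComplex.mpr (IsTotallyComplex.isComplex w)
      (IsTotallyReal.isReal w)
  omega

theorem cmRank_le (hquad : Module.finrank F₀ F = 2) : cmRank F ≤ Module.finrank ℚ F₀ := by
  classical
  rw [cmRank]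
  split_ifs with h
  · have h1 := two_mul_finrank_eq (F₀ := F₀) (F := F) hquad
    have h2 := (two_le_finrank_maximalRealSubfield h).2
    nlinarith
  · exact Nat.zero_le _

theorem cmRank_lt (hquad : Module.finrank F₀ F = 2) (hF : ¬ IsCMField F) :
    cmRank F < Module.finrank ℚ F₀ := by
  classical
  refine lt_of_le_of_ne (cmRank_le hquad) fun heq => ?_
  have hpos : 0 < Module.finrank ℚ F₀ := Module.finrank_pos
  rw [cmRank] at heq
  split_ifs at heq with h
  · have h1 := two_mul_finrank_eq (F₀ := F₀) (F := F) hquad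
    rw [heq] at h1
    have h2 := Nat.eq_of_mul_eq_mul_left hpos h1
    exact hF { to_isTotallyComplex := (two_le_finrank_maximalRealSubfield h).1,
               is_quadratic := ⟨h2.symm⟩ }
  · omega

theorem exists_involution (hquad : Module.finrank F₀ F = 2) :
    ∃ c : F →+* F, c.comp c = RingHom.id F ∧ c ≠ RingHom.id F ∧
      c.comp (algebraMap F₀ F) = algebraMap F₀ F ∧
      ∀ σ τ : F →+* ℂ, σ.comp (algebraMap F₀ F) = τ.comp (algebraMap F₀ F) →
        τ = σ ∨ τ = σ.comp c := by
  have : Algebra.IsQuadraticExtension F₀ F := ⟨hquad⟩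
  have : FiniteDimensional F₀ F := Module.finite_of_finrank_eq_succ hquad
  have hcard : Nat.card Gal(F/F₀) = 2 := by rw [IsGalois.card_aut_eq_finrank, hquad]
  obtain ⟨c, hc, huniq⟩ := (Nat.card_eq_two_iff' (1 : Gal(F/F₀))).mp hcard
  have hcc : c * c = 1 := by
    by_contra h
    have := huniq _ h
    exact hc (by simpa using this)
  refine ⟨(c : F →+* F), ?_, ?_, ?_, fun σ τ h => ?_⟩
  · ext x
    exact AlgEquiv.congr_fun hcc x
  · intro h
    apply hc
    ext x
    exact RingHom.congr_fun h x
  · ext x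
    exact c.commutes x
  · obtain ⟨g, hg⟩ := ComplexEmbedding.exists_comp_symm_eq_of_comp_eq σ τ h
    by_cases h1 : g.symm = 1
    · left
      rw [← hg, h1]
      rfl
    · right
      rw [← hg, huniq _ h1]

theorem exists_linearIndependent_continuousParameters
    {c : F →+* F} (hc : c.comp c = RingHom.id F) (hc1 : c ≠ RingHom.id F)
    (hc0 : c.comp (algebraMap F₀ F) = algebraMap F₀ F) :
    ∃ p : Fin (Module.finrank ℚ F₀ - cmRank F) → antiParameters c,
      LinearIndependent ℤ fun i => (p i).1.2 := by
  have hlift := fun τ : F₀ →+* ℂ => ComplexEmbedding.lift_comp_algebraMap F τ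
  have h1 := natCast_card_le_rank_antiParameters hc (ComplexEmbedding.lift F (k := F₀))
    (fun η η' h => by rw [← hlift η, ← hlift η', h]) (fun η η' h => by
      have h2 : η = η' := by
        rw [← hlift η, ← hlift η', ← h, RingHom.comp_assoc, hc0]
      subst h2
      apply hc1
      ext x
      exact (ComplexEmbedding.lift F η).injective (RingHom.congr_fun h x))
  rw [Embeddings.card, ← LinearMap.rank_range_add_rank_ker (continuousParameters c)] at h1
  have h2 := h1.trans (add_le_add_right (rank_ker_continuousParameters_le c) _)
  have h3 : ((Module.finrank ℚ F₀ - cmRank F : ℕ) : Cardinal) ≤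
      Module.rank ℤ (LinearMap.range (continuousParameters c)) := by
    rcases lt_or_ge (Module.rank ℤ (LinearMap.range (continuousParameters c))) Cardinal.aleph0
      with h | h
    · obtain ⟨a, ha⟩ := Cardinal.lt_aleph0.mp h
      rw [ha] at h2 ⊢
      have h4 : Module.finrank ℚ F₀ ≤ a + cmRank F := by exact_mod_cast h2
      exact_mod_cast Nat.sub_le_iff_le_add.mpr h4
    · exact (Cardinal.natCast_lt_aleph0).le.trans h
  obtain ⟨w, hw⟩ := Module.le_rank_iff.mp h3
  choose p hp using fun i => (w i).2
  refine ⟨p, ?_⟩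
  have h4 := hw.map' (LinearMap.range (continuousParameters c)).subtype
    (Submodule.ker_subtype _)
  have h5 : (fun i => (p i).1.2) =
      (LinearMap.range (continuousParameters c)).subtype ∘ w := funext fun i => hp i
  rw [h5]
  exact h4

/-- The subgroup generated by Hecke characters whose continuous parameters are linearly
independent is free and contains no nontrivial almost-algebraic character. -/
theorem rank_subgroup_of_linearIndependent {n : ℕ} {χ : Fin n → HeckeCharacter F}
    {k : Fin n → (F →+* ℂ) → ℤ} {φ : Fin n → (F →+* ℂ) → ℝ}
    (hφ : ∀ i σ, φ i (ComplexEmbedding.conjugate σ) = φ i σ) (hli : LinearIndependent ℤ φ)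
    (hχ : ∀ i, ∀ w : InfinitePlace F,
      HasArchParameters (χ i) w (2 * k i w.embedding) (φ i w.embedding)) :
    ∃ H : Subgroup (HeckeCharacter F), (∀ G : Subgroup (HeckeCharacter F), (∀ i, χ i ∈ G) → H ≤ G) ∧
      Module.rank ℤ (Additive H) = n ∧
      (∀ χ' ∈ H, ∀ w : InfinitePlace F, (∀ i, φ i w.embedding = 0) → HasPhi χ' w 0) ∧
      ∀ χ' ∈ H, IsAlmostAlgebraic χ' → χ' = 1 := by
  let Φ : Multiplicative (Fin n → ℤ) →* HeckeCharacter F :=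
    { toFun := fun a => ∏ i, χ i ^ (a.toAdd i)
      map_one' := by simp
      map_mul' := fun a b => by
        simp only [toAdd_mul, Pi.add_apply, zpow_add, Finset.prod_mul_distrib] }
  have hΦ : ∀ a, ∀ w : InfinitePlace F, HasPhi (Φ a) w (∑ i, a.toAdd i * φ i w.embedding) :=
    fun a w => ⟨_, (HasArchParameters.prod Finset.univ fun i _ =>
      (hχ i w).zpow (a.toAdd i)).hasLocalParameters⟩
  have hΦ1 : ∀ a, IsAlmostAlgebraic (Φ a) → a = 1 := by
    intro a ha
    have h0 : ∀ σ, ∑ i, a.toAdd i * φ i σ = 0 := by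
      intro σ
      have h1 := (hΦ a (InfinitePlace.mk σ)).unique (ha (InfinitePlace.mk σ))
      rcases InfinitePlace.embedding_mk_eq σ with h | h
      · rwa [h] at h1
      · simpa only [h, hφ] using h1
    have h2 := Fintype.linearIndependent_iff.mp hli a.toAdd (by
      ext σ
      simpa using h0 σ)
    exact congrArg Multiplicative.ofAdd (funext h2)
  have hinj : Function.Injective Φ := by
    rw [injective_iff_map_eq_one]
    intro a ha
    exact hΦ1 a (by rw [ha]; exact isAlmostAlgebraic_one)
  refine ⟨Φ.range, ?_, ?_, ?_, ?_⟩
  · rintro G hG _ ⟨a, rfl⟩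
    change ∏ i, χ i ^ (a.toAdd i) ∈ G
    exact Subgroup.prod_mem _ fun i _ => Subgroup.zpow_mem _ (hG i) _
  · let e : (Fin n → ℤ) ≃+ Additive Φ.range :=
      { toFun := fun a => Additive.ofMul (MonoidHom.ofInjective hinj (Multiplicative.ofAdd a))
        invFun := fun x => ((MonoidHom.ofInjective hinj).symm x.toMul).toAdd
        left_inv := fun a => by simp
        right_inv := fun x => by simp
        map_add' := fun a b => by rw [ofAdd_add, map_mul, ofMul_mul] }
    have h1 := e.toIntLinearEquiv.lift_rank_eq
    rw [rank_fun', Fintype.card_fin, Cardinal.lift_natCast] at h1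
    simpa using h1.symm
  · rintro _ ⟨a, rfl⟩ w hw
    have := hΦ a w
    simpa [hw] using this
  · rintro _ ⟨a, rfl⟩ h
    rw [hΦ1 a h, map_one]

/-- A nonzero continuous parameter gives rise to a partially algebraic character. -/
theorem exists_isPartiallyAlgebraic {c : F →+* F} (p : antiParameters c) (hp : p.1.2 ≠ 0) :
    ∃ χ : HeckeCharacter F, IsPartiallyAlgebraic χ := by
  obtain ⟨hk, -, hφ, hφ', hu⟩ := p.2
  generalize p.1.1 = k at hk hu
  generalize p.1.2 = φ at hφ hφ' hu hp
  have hmk : ∀ σ, φ (InfinitePlace.mk σ).embedding = φ σ := by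
    intro σ
    rcases InfinitePlace.embedding_mk_eq σ with h | h
    · rw [h]
    · rw [h, hφ]
  obtain ⟨σ, hσ⟩ := Function.ne_iff.mp hp
  rw [Pi.zero_apply] at hσ
  obtain ⟨χ, -, hχ⟩ := exists_heckeCharacter_of_unitCharacter hk
    (φ := φ + fun _ => -φ σ) (fun τ => by simp only [Pi.add_apply, hφ]) (fun u => by
      rw [← add_zero k, unitCharacter_add, hu u, one_mul, unitCharacter_zero_left,
        logPairing_const, AddMonoidHom.zero_apply, Circle.exp_zero])
  refine ⟨χ, ⟨InfinitePlace.mk σ, ?_⟩, InfinitePlace.mk (σ.comp c), -2 * φ σ, ?_, ?_⟩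
  · have := (hχ (InfinitePlace.mk σ)).hasLocalParameters
    rw [Pi.add_apply, hmk, add_neg_cancel] at this
    exact ⟨_, this⟩
  · exact mul_ne_zero (by norm_num) hσ
  · have := (hχ (InfinitePlace.mk (σ.comp c))).hasLocalParameters
    rw [Pi.add_apply, hmk, hφ' σ, show -φ σ + -φ σ = -2 * φ σ by ring] at this
    exact ⟨_, this⟩

end Hecke

theorem mainTheorem11 {F₀ F : Type*} [Field F₀] [NumberField F₀] [Field F] [NumberField F]
    [Algebra F₀ F] (hquad : Module.finrank F₀ F = 2) :
    (∀ m : Hecke.Modulus F, ∃ H : Subgroup (Hecke.HeckeCharacter F),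
      H ≤ Hecke.characterGroup m ∧
      Module.rank ℤ (Additive H) + (Hecke.cmRank F : Cardinal) =
        (Module.finrank ℚ F₀ : Cardinal) ∧
      (∀ χ ∈ H, ∀ w : InfinitePlace F,
        w.IsComplex → (w.comap (algebraMap F₀ F)).IsReal → Hecke.HasPhi χ w 0) ∧
      (∀ χ ∈ H, Hecke.IsAlmostAlgebraic χ → χ = 1)) ∧
    (¬ IsCMField F → ∃ χ : Hecke.HeckeCharacter F, Hecke.IsPartiallyAlgebraic χ) := by
  obtain ⟨c, hc, hc1, hc0, hcc⟩ := Hecke.exists_involution hquad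
  obtain ⟨p, hp⟩ := Hecke.exists_linearIndependent_continuousParameters hc hc1 hc0
  have hle := Hecke.cmRank_le hquad
  refine ⟨fun m => ?_, fun hF => ?_⟩
  · choose χ hχm hχ using fun i => Hecke.exists_heckeCharacter_of_unitCharacter
      (p i).2.1 (p i).2.2.2.1 (p i).2.2.2.2.2
    obtain ⟨H, hH, hrank, hphi, halg⟩ :=
      Hecke.rank_subgroup_of_linearIndependent (fun i => (p i).2.2.2.1) hp hχ
    refine ⟨H, hH _ fun i => hχm i m, ?_, fun χ' hχ' w hw hw0 => hphi χ' hχ' w fun i => ?_, halg⟩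
    · rw [hrank, ← Nat.cast_add, Nat.sub_add_cancel hle]
    · have h1 : w.embedding.comp (algebraMap F₀ F) =
          (ComplexEmbedding.conjugate w.embedding).comp (algebraMap F₀ F) := by
        rw [← InfinitePlace.mk_embedding w, InfinitePlace.comap_mk,
          InfinitePlace.isReal_mk_iff, ComplexEmbedding.isReal_iff] at hw0
        rw [ComplexEmbedding.conjugate_comp, hw0]
      rcases hcc _ _ h1 with h2 | h2
      · exact absurd (ComplexEmbedding.isReal_iff.mpr h2) (InfinitePlace.isComplex_iff.mp hw)
      · have h3 := (p i).2.2.2.1 w.embedding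
        have h4 := (p i).2.2.2.2.1 w.embedding
        rw [h2] at h3
        linarith
  · have hlt := Hecke.cmRank_lt hquad hF
    exact Hecke.exists_isPartiallyAlgebraic (p ⟨0, by omega⟩) (hp.ne_zero _)
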